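/- **Setting.** Let $\Omega\subset\mathbb R^d$ ($d\ge 1$) be a bounded open set with Lipschitz boundary, and let $\partial_u\Omega\neq\emptyset$ and $\partial_q\Omega$ be disjoint measurable subsets of $\partial\Omega$ with $\overline{\partial_u\Omega\cup\partial_q\Omega}=\partial\Omega$. Let $I=[0,T]$ with $T>0$, let $\mathcal V=\{v\in H^1(\Omega): v=0 \text{ on } \partial_u\Omega\}$, and let $P\subset\mathbb R^{n_p}$ be a set of parameters. For each $p\in P$ let $c,k,r\in L^\infty(\Omega)$ be coefficients (depending on $p$) with $c\ge c_0>0$, $k\ge k_0>0$ and $r\ge 0$ a.e. in $\Omega$. Let $f_d\in L^2(I;L^2(\Omega))$, $g_d\in L^2(I;L^2(\partial_q\Omega))$, and (possibly depending on $p$) $q_\Sigma\in L^2(I;L^2(\Omega)^d)$, $f_\Sigma\in L^2(I;L^2(\Omega))$. Let $W$ be the space of all $v\in L^2(I;\mathcal V)$ with $c\,\partial_t v\in L^2(I;\mathcal V^*)$, where the duality pairing extends the inner product of $L^2(\Omega)$; its elements have representatives in $C(I;L^2(\Omega))$, which give the values at $t=0$ and $t=T$. Integrals of $c\,\partial_t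 v\,w$ over $\Omega$ denote this pairing. Quotients $a^2/r$ at points where $r=0$ are $0$ if $a=0$ and $+\infty$ otherwise (in products, $\frac1r\cdot 0\cdot 0=0$ there). Put $$b(u,v)=\int_I\int_\Omega (c\,\partial_t u\,v+k\nabla u\cdot\nabla v+r\,u\,v)\,d\Omega\,dt,\qquad l(v)=\int_I\Big(\int_\Omega f_d v\,d\Omega+\int_{\partial_q\Omega} g_d v\,dS\Big)dt,$$ $$Q(v)=\int_I\int_\Omega (q_\Sigma\cdot\nabla v+f_\Sigma v)\,d\Omega\,dt .$$ For each $p\in P$ let $u\in W$ with $u|_{t=0}=0$ and $b(u,v)=l(v)$ for all $v\in L^2(I;\mathcal V)$. **Admissible triplets.** For each $p\in P$ let $(u_m,\hat q_m,\hat z_m)$ and $(\tilde u_{m'},\hat{\tilde q}_{m'},\hat{\tilde z}_{m'})$ be elements of $W\times L^2(I;L^2(\Omega)^d)\times L^2(I;L^2(\Omega))$ such that $u_m|_{t=0}=0$, $\tilde u_{m'}|_{t=T}=0$ and, for a.e. $t\in I$ and all $v\in\mathcal V$, $$\int_\Omega (c\,\partial_t u_m v+\hat q_m\cdot\nabla v+\hat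 z_m v)\,d\Omega=\int_\Omega f_d v\,d\Omega+\int_{\partial_q\Omega}g_d v\,dS,$$ $$\int_\Omega (-c\,\partial_t \tilde u_{m'} v+\hat{\tilde q}_{m'}\cdot\nabla v+\hat{\tilde z}_{m'} v)\,d\Omega=\int_\Omega (q_\Sigma\cdot\nabla v+f_\Sigma v)\,d\Omega$$ (the second equation is the equilibrium of the backward-in-time adjoint problem). Define $$E_{\rm CRE}^2=\int_I\int_\Omega\Big(\tfrac1k|\hat q_m-k\nabla u_m|^2+\tfrac1r(\hat z_m-r u_m)^2\Big)d\Omega\,dt,\qquad \tilde E_{\rm CRE}^2=\int_I\int_\Omega\Big(\tfrac1k|\hat{\tilde q}_{m'}-k\nabla\tilde u_{m'}|^2+\tfrac1r(\hat{\tilde z}_{m'}-r\tilde u_{m'})^2\Big)d\Omega\,dt,$$ and assume that both are finite. Let $\Delta Q=Q(u)-Q(u_m)$, $R(v)=l(v)-b(u_m,v)$, let $$(\hat q_m^*,\hat z_m^*)=\tfrac12\big[(\hat q_m,\hat z_m)+(k\nabla u_m,ru_m)\big],\qquad (\hat{\tilde q}{}_{m'}^{*},\hat{\tilde z}{}_{m'}^{*})=\tfrac12\big[(\hat{\tilde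 q}_{m'},\hat{\tilde z}_{m'})+(k\nabla\tilde u_{m'},r\tilde u_{m'})\big],$$ and $$Q_{\rm corr}=\int_I\int_\Omega\Big(\tfrac1k(\hat q_m-k\nabla u_m)\cdot\hat{\tilde q}{}_{m'}^{*}+\tfrac1r(\hat z_m-ru_m)\,\hat{\tilde z}{}_{m'}^{*}\Big)d\Omega\,dt .$$ **Claim.** For every $p\in P$, $$|\Delta Q-R(\tilde u_{m'})|\le \tilde E_{\rm CRE}\,E_{\rm CRE},$$ $$Q_{\rm corr}=R(\tilde u_{m'})+\int_I\int_\Omega\Big(\tfrac1k(\hat{\tilde q}_{m'}-k\nabla\tilde u_{m'})\cdot(\hat q_m^*-k\nabla u_m)+\tfrac1r(\hat{\tilde z}_{m'}-r\tilde u_{m'})(\hat z_m^*-ru_m)\Big)d\Omega\,dt,$$ $$|Q(u)-Q(u_m)-Q_{\rm corr}|\le \tfrac12\,\tilde E_{\rm CRE}\,E_{\rm CRE}.$$ -/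

import Mathlib

open MeasureTheory Set Topology
open scoped ENNReal NNReal ContDiff RealInnerProductSpace

noncomputable section

namespace ParabolicCRE

/-- The Euclidean space `ℝ^d`. -/
abbrev E (d : ℕ) : Type := EuclideanSpace ℝ (Fin d)

variable {d : ℕ}

/-! ### The space domain, its boundary and the Sobolev space -/

/-- The boundary of `Ω` is locally the graph of a Lipschitz function, with `Ω` on one side of it:
near each boundary point there are a unit vector `e` and a Lipschitz function `γ` of the component
of `x` orthogonal to `e` such that `Ω` is given by `γ < ⟪e, x⟫`. -/
def HasLipschitzBoundary (Ω : Set (E d)) : Prop :=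
  ∀ x₀ ∈ frontier Ω, ∃ (e : E d) (ρ : ℝ) (K : ℝ≥0) (γ : E d → ℝ),
    ‖e‖ = 1 ∧ 0 < ρ ∧ LipschitzWith K γ ∧
      ∀ x ∈ Metric.ball x₀ ρ, x ∈ Ω ↔ γ (x - ⟪e, x⟫ • e) < ⟪e, x⟫

/-- The surface measure of `∂Ω`: the `(d - 1)`-dimensional Hausdorff measure (with the Euclidean
normalization) restricted to the boundary. -/
def surfaceMeasure (Ω : Set (E d)) : Measure (E d) :=
  (μHE[d - 1] : Measure (E d)).restrict (frontier Ω)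

/-- `L²(Ω)`. -/
abbrev L2 (Ω : Set (E d)) : Type := Lp ℝ 2 (volume.restrict Ω)

/-- `L²(Ω)^d`. -/
abbrev L2Vec (Ω : Set (E d)) : Type := Lp (E d) 2 (volume.restrict Ω)

/-- `g` is the weak gradient of `v` in `Ω`. -/
def IsWeakGradient (Ω : Set (E d)) (v : L2 Ω) (g : L2Vec Ω) : Prop :=
  ∀ φ : E d → ℝ, ContDiff ℝ ∞ φ → HasCompactSupport φ → tsupport φ ⊆ Ω → ∀ e : E d,
    ∫ x in Ω, v x * fderiv ℝ φ x e = - ∫ x in Ω, ⟪g x, e⟫ * φ x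

theorem integrable_testDeriv {Ω : Set (E d)} (v : L2 Ω) {φ : E d → ℝ} (hφ : ContDiff ℝ ∞ φ)
    (hc : HasCompactSupport φ) (e : E d) :
    Integrable (fun x => v x * fderiv ℝ φ x e) (volume.restrict Ω) := by
  have hcont : Continuous (fun x => fderiv ℝ φ x e) :=
    (hφ.continuous_fderiv (by simp)).clm_apply continuous_const
  have hsupp : HasCompactSupport (fun x => fderiv ℝ φ x e) := hc.fderiv_apply (𝕜 := ℝ) e
  exact (Lp.memLp v).integrable_mul (q := 2) (hcont.memLp_of_hasCompactSupport hsupp)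

theorem integrable_gradTest {Ω : Set (E d)} (g : L2Vec Ω) {φ : E d → ℝ} (hφ : ContDiff ℝ ∞ φ)
    (hc : HasCompactSupport φ) (e : E d) :
    Integrable (fun x => ⟪g x, e⟫ * φ x) (volume.restrict Ω) := by
  have h1 : MemLp (fun x => ⟪g x, e⟫) 2 (volume.restrict Ω) := (Lp.memLp g).inner_const e
  exact h1.integrable_mul (q := 2) (hφ.continuous.memLp_of_hasCompactSupport hc)

/-- The pairs `(v, ∇v)` in `L²(Ω) × L²(Ω)^d` whose second component is the weak gradient of the
first. -/
def h1Submodule (Ω : Set (E d)) : Submodule ℝ (WithLp 2 (L2 Ω × L2Vec Ω)) where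
  carrier := {p | IsWeakGradient Ω p.fst p.snd}
  zero_mem' := by
    intro φ _ _ _ e
    have h1 : ∫ x in Ω, (0 : L2 Ω) x * fderiv ℝ φ x e = 0 := by
      rw [integral_eq_zero_of_ae]
      filter_upwards [Lp.coeFn_zero ℝ 2 (volume.restrict Ω)] with x hx
      rw [hx]; simp
    have h2 : ∫ x in Ω, ⟪(0 : L2Vec Ω) x, e⟫ * φ x = 0 := by
      rw [integral_eq_zero_of_ae]
      filter_upwards [Lp.coeFn_zero (E d) 2 (volume.restrict Ω)] with x hx
      rw [hx]; simp
    change ∫ x in Ω, (0 : L2 Ω) x * fderiv ℝ φ x e = - ∫ x in Ω, ⟪(0 : L2Vec Ω) x, e⟫ * φ x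
    rw [h1, h2, neg_zero]
  add_mem' := by
    intro p q hp hq φ hφ hc hs e
    have h1 : ∫ x in Ω, (p.fst + q.fst : L2 Ω) x * fderiv ℝ φ x e
        = (∫ x in Ω, p.fst x * fderiv ℝ φ x e) + ∫ x in Ω, q.fst x * fderiv ℝ φ x e := by
      rw [← integral_add (integrable_testDeriv _ hφ hc e) (integrable_testDeriv _ hφ hc e)]
      refine integral_congr_ae ?_
      filter_upwards [Lp.coeFn_add p.fst q.fst] with x hx
      rw [hx, Pi.add_apply, add_mul]
    have h2 : ∫ x in Ω, ⟪(p.snd + q.snd : L2Vec Ω) x, e⟫ * φ x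
        = (∫ x in Ω, ⟪p.snd x, e⟫ * φ x) + ∫ x in Ω, ⟪q.snd x, e⟫ * φ x := by
      rw [← integral_add (integrable_gradTest _ hφ hc e) (integrable_gradTest _ hφ hc e)]
      refine integral_congr_ae ?_
      filter_upwards [Lp.coeFn_add p.snd q.snd] with x hx
      rw [hx, Pi.add_apply, inner_add_left, add_mul]
    change ∫ x in Ω, (p.fst + q.fst : L2 Ω) x * fderiv ℝ φ x e
        = - ∫ x in Ω, ⟪(p.snd + q.snd : L2Vec Ω) x, e⟫ * φ x
    rw [h1, h2, hp φ hφ hc hs e, hq φ hφ hc hs e]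
    ring
  smul_mem' := by
    intro a p hp φ hφ hc hs e
    have h1 : ∫ x in Ω, (a • p.fst : L2 Ω) x * fderiv ℝ φ x e
        = a * ∫ x in Ω, p.fst x * fderiv ℝ φ x e := by
      rw [← integral_const_mul]
      refine integral_congr_ae ?_
      filter_upwards [Lp.coeFn_smul a p.fst] with x hx
      rw [hx, Pi.smul_apply, smul_eq_mul, mul_assoc]
    have h2 : ∫ x in Ω, ⟪(a • p.snd : L2Vec Ω) x, e⟫ * φ x
        = a * ∫ x in Ω, ⟪p.snd x, e⟫ * φ x := by
      rw [← integral_const_mul]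
      refine integral_congr_ae ?_
      filter_upwards [Lp.coeFn_smul a p.snd] with x hx
      rw [hx, Pi.smul_apply, inner_smul_left, mul_assoc]; rfl
    change ∫ x in Ω, (a • p.fst : L2 Ω) x * fderiv ℝ φ x e
        = - ∫ x in Ω, ⟪(a • p.snd : L2Vec Ω) x, e⟫ * φ x
    rw [h1, h2, hp φ hφ hc hs e]
    ring

/-- The Sobolev space `H¹(Ω)`: pairs `(v, ∇v)` with the Hilbert norm `(‖v‖² + ‖∇v‖²)^(1/2)`. -/
def H1 (Ω : Set (E d)) : Type := ↥(h1Submodule Ω)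

instance (Ω : Set (E d)) : NormedAddCommGroup (H1 Ω) :=
  inferInstanceAs (NormedAddCommGroup ↥(h1Submodule Ω))

instance (Ω : Set (E d)) : InnerProductSpace ℝ (H1 Ω) :=
  inferInstanceAs (InnerProductSpace ℝ ↥(h1Submodule Ω))

/-- The function underlying an element of `H¹(Ω)`. -/
def H1.fn {Ω : Set (E d)} (v : H1 Ω) : L2 Ω := v.1.fst

/-- The weak gradient of an element of `H¹(Ω)`. -/
def H1.grad {Ω : Set (E d)} (v : H1 Ω) : L2Vec Ω := v.1.snd

/-- `τ` is the trace operator `H¹(Ω) → L²(∂Ω)`: the continuous linear map that restricts to the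
boundary every function which is smooth up to the boundary. -/
def IsTraceOperator (Ω : Set (E d)) (τ : H1 Ω →L[ℝ] Lp ℝ 2 (surfaceMeasure Ω)) : Prop :=
  ∀ φ : E d → ℝ, ContDiff ℝ ∞ φ → ∀ v : H1 Ω,
    (v.fn =ᵐ[volume.restrict Ω] φ) → (τ v =ᵐ[surfaceMeasure Ω] φ)

open Classical in
/-- The trace operator `H¹(Ω) → L²(∂Ω)`. It exists and is unique for bounded Lipschitz domains
(the value `0` is used for sets without a trace operator). -/
def trace (Ω : Set (E d)) : H1 Ω →L[ℝ] Lp ℝ 2 (surfaceMeasure Ω) :=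
  if h : ∃ τ, IsTraceOperator Ω τ then h.choose else 0

/-- The functions of `H¹(Ω)` whose trace vanishes on the part `Γu` of the boundary. -/
def vSubmodule (Ω Γu : Set (E d)) : Submodule ℝ (H1 Ω) where
  carrier := {v | ∀ᵐ x ∂((surfaceMeasure Ω).restrict Γu), trace Ω v x = 0}
  zero_mem' := by
    change ∀ᵐ x ∂((surfaceMeasure Ω).restrict Γu), trace Ω 0 x = 0
    rw [map_zero]
    filter_upwards [ae_restrict_of_ae (Lp.coeFn_zero ℝ 2 (surfaceMeasure Ω))] with x hx
    rw [hx]; rfl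
  add_mem' := by
    intro v w hv hw
    change ∀ᵐ x ∂((surfaceMeasure Ω).restrict Γu), trace Ω (v + w) x = 0
    rw [map_add]
    filter_upwards [hv, hw, ae_restrict_of_ae (Lp.coeFn_add (trace Ω v) (trace Ω w))]
      with x h1 h2 h3
    rw [h3, Pi.add_apply, h1, h2, add_zero]
  smul_mem' := by
    intro a v hv
    change ∀ᵐ x ∂((surfaceMeasure Ω).restrict Γu), trace Ω (a • v) x = 0
    rw [map_smul]
    filter_upwards [hv, ae_restrict_of_ae (Lp.coeFn_smul a (trace Ω v))] with x h1 h2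
    rw [h2, Pi.smul_apply, h1, smul_zero]

variable {Ω Γu : Set (E d)}

/-- The Hilbert space `𝒱` of the functions of `H¹(Ω)` that vanish on the part `Γu` of the boundary,
with the norm of `H¹(Ω)`. -/
def V (Ω Γu : Set (E d)) : Type := ↥(vSubmodule Ω Γu)

instance (Ω Γu : Set (E d)) : NormedAddCommGroup (V Ω Γu) :=
  inferInstanceAs (NormedAddCommGroup ↥(vSubmodule Ω Γu))

instance (Ω Γu : Set (E d)) : InnerProductSpace ℝ (V Ω Γu) :=
  inferInstanceAs (InnerProductSpace ℝ ↥(vSubmodule Ω Γu))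

/-- An element of `𝒱` as an element of `H¹(Ω)`. -/
def V.toH1 (v : V Ω Γu) : H1 Ω := v.1

/-- The function underlying an element of `𝒱`. -/
def V.fn (v : V Ω Γu) : L2 Ω := v.toH1.fn

/-- The gradient of an element of `𝒱`. -/
def V.grad (v : V Ω Γu) : L2Vec Ω := v.toH1.grad

/-! ### Spaces of functions of time -/

/-- The Lebesgue measure on the time interval `I = [0, T]`. -/
def timeMeasure (T : ℝ) : Measure ℝ := volume.restrict (Icc 0 T)

/-- The Bochner space `L²(I; X)`. -/
abbrev L2Time (T : ℝ) (X : Type*) [NormedAddCommGroup X] : Type _ := Lp X 2 (timeMeasure T)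

/-- The space of the functions `u ∈ L²(I; 𝒱)` such that `c ∂u/∂t ∈ L²(I; 𝒱*)`, where the duality
pairing extends the inner product of `L²(Ω)`: `c ∂u/∂t` is the derivative, in the sense of
distributions in time, of the functional `v ↦ ∫_Ω c u(t) v`. -/
structure Evolution (Ω Γu : Set (E d)) (T : ℝ) (c : E d → ℝ) where
  /-- the function `u` itself -/
  toFun : L2Time T (V Ω Γu)
  /-- the functional `c ∂u/∂t` -/
  cdt : L2Time T (StrongDual ℝ (V Ω Γu))
  weak_deriv : ∀ v : V Ω Γu, ∀ φ : ℝ → ℝ, ContDiff ℝ ∞ φ → HasCompactSupport φ →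
    tsupport φ ⊆ Ioo 0 T →
      ∫ t, deriv φ t * (∫ x in Ω, c x * (toFun t).fn x * v.fn x) ∂(timeMeasure T)
        = - ∫ t, φ t * cdt t v ∂(timeMeasure T)

variable {T : ℝ} {c : E d → ℝ}

/-- `u = 0` at the time `t₀ ∈ [0, T]`: the representative of `u` in `C([0, T]; L²(Ω))` vanishes
at `t₀`. -/
def Evolution.VanishesAt (u : Evolution Ω Γu T c) (t₀ : ℝ) : Prop :=
  ∃ w : ℝ → L2 Ω, ContinuousOn w (Icc 0 T) ∧
    (∀ᵐ t ∂(timeMeasure T), w t = (u.toFun t).fn) ∧ w t₀ = 0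

/-! ### The parabolic problem -/

/-- Conditions on the coefficients of the equation for a fixed value of the parameters: they are
measurable and essentially bounded, `c` and `k` are bounded from below by positive constants, and
`r` is nonnegative (so that `r` may vanish, as it does in pure diffusion problems). -/
structure AdmissibleCoefficients (Ω : Set (E d)) (c k r : E d → ℝ) : Prop where
  c_meas : AEMeasurable c (volume.restrict Ω)
  k_meas : AEMeasurable k (volume.restrict Ω)
  r_meas : AEMeasurable r (volume.restrict Ω)
  c_bound : ∃ c₀ c₁ : ℝ, 0 < c₀ ∧ ∀ᵐ x ∂(volume.restrict Ω), c₀ ≤ c x ∧ c x ≤ c₁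
  k_bound : ∃ k₀ k₁ : ℝ, 0 < k₀ ∧ ∀ᵐ x ∂(volume.restrict Ω), k₀ ≤ k x ∧ k x ≤ k₁
  r_bound : ∃ r₁ : ℝ, ∀ᵐ x ∂(volume.restrict Ω), 0 ≤ r x ∧ r x ≤ r₁

/-- The bilinear form `b(u, v) = ∫_I ∫_Ω (c ∂u/∂t v + k ∇u · ∇v + r u v)`. -/
def b (k r : E d → ℝ) (u : Evolution Ω Γu T c) (v : L2Time T (V Ω Γu)) : ℝ :=
  ∫ t, (u.cdt t (v t) + ∫ x in Ω, (k x * ⟪(u.toFun t).grad x, (v t).grad x⟫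
    + r x * (u.toFun t).fn x * (v t).fn x)) ∂(timeMeasure T)

/-- The load at a given time, `∫_Ω f v + ∫_{Γq} g v dS`. -/
def spaceLoad {Γq : Set (E d)} (f : L2 Ω) (g : Lp ℝ 2 ((surfaceMeasure Ω).restrict Γq))
    (v : V Ω Γu) : ℝ :=
  (∫ x in Ω, f x * v.fn x) + ∫ x, g x * trace Ω v.toH1 x ∂((surfaceMeasure Ω).restrict Γq)

/-- The linear form `l(v) = ∫_I (∫_Ω f_d v + ∫_{Γq} g_d v dS) dt`. -/
def l {Γq : Set (E d)} (f : L2Time T (L2 Ω))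
    (g : L2Time T (Lp ℝ 2 ((surfaceMeasure Ω).restrict Γq))) (v : L2Time T (V Ω Γu)) : ℝ :=
  ∫ t, spaceLoad (f t) (g t) (v t) ∂(timeMeasure T)

/-- `u` is the solution of the space-time weak formulation: `u = 0` at `t = 0` and
`b(u, v) = l(v)` for all `v ∈ L²(I; 𝒱)`. -/
def IsWeakSolution {Γq : Set (E d)} (k r : E d → ℝ) (f : L2Time T (L2 Ω))
    (g : L2Time T (Lp ℝ 2 ((surfaceMeasure Ω).restrict Γq))) (u : Evolution Ω Γu T c) : Prop :=
  u.VanishesAt 0 ∧ ∀ v : L2Time T (V Ω Γu), b k r u v = l f g v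

/-- The weak residual `R(v) = l(v) - b(u_m, v)`. -/
def R {Γq : Set (E d)} (k r : E d → ℝ) (f : L2Time T (L2 Ω))
    (g : L2Time T (Lp ℝ 2 ((surfaceMeasure Ω).restrict Γq))) (um : Evolution Ω Γu T c)
    (v : L2Time T (V Ω Γu)) : ℝ :=
  l f g v - b k r um v

/-- The output `Q(v) = ∫_I ∫_Ω (q_Σ · ∇v + f_Σ v)`. -/
def Q (qS : L2Time T (L2Vec Ω)) (fS : L2Time T (L2 Ω)) (v : L2Time T (V Ω Γu)) : ℝ :=
  ∫ t, (∫ x in Ω, (⟪qS t x, (v t).grad x⟫ + fS t x * (v t).fn x)) ∂(timeMeasure T)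

/-! ### Admissible triplets and the constitutive relation error -/

/-- `(û, q̂, ẑ)` is an admissible triplet of the primal problem: initial condition, Dirichlet
condition (contained in `𝒱`) and full equilibrium in space at almost every time. -/
structure IsPrimalAdmissible {Γq : Set (E d)} (f : L2Time T (L2 Ω))
    (g : L2Time T (Lp ℝ 2 ((surfaceMeasure Ω).restrict Γq)))
    (u : Evolution Ω Γu T c) (q : L2Time T (L2Vec Ω)) (z : L2Time T (L2 Ω)) : Prop where
  initial : u.VanishesAt 0
  equilibrium : ∀ᵐ t ∂(timeMeasure T), ∀ v : V Ω Γu,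
    u.cdt t v + ∫ x in Ω, (⟪q t x, v.grad x⟫ + z t x * v.fn x) = spaceLoad (f t) (g t) v

/-- `(û, q̂, ẑ)` is an admissible triplet of the adjoint problem, which is backward in time and
loaded by the extractors `(q_Σ, f_Σ)`. -/
structure IsAdjointAdmissible (qS : L2Time T (L2Vec Ω)) (fS : L2Time T (L2 Ω))
    (u : Evolution Ω Γu T c) (q : L2Time T (L2Vec Ω)) (z : L2Time T (L2 Ω)) : Prop where
  final : u.VanishesAt T
  equilibrium : ∀ᵐ t ∂(timeMeasure T), ∀ v : V Ω Γu,
    - u.cdt t v + ∫ x in Ω, (⟪q t x, v.grad x⟫ + z t x * v.fn x)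
      = ∫ x in Ω, (⟪qS t x, v.grad x⟫ + fS t x * v.fn x)

/-- The squared constitutive relation error in space
`e_CRE² = ∫_Ω (1/k |q̂ - k∇û|² + 1/r (ẑ - rû)²)` at a given time. -/
def creSpaceSq (k r : E d → ℝ) (u : V Ω Γu) (q : L2Vec Ω) (z : L2 Ω) : ℝ :=
  ∫ x in Ω, (1 / k x * ‖q x - k x • u.grad x‖ ^ 2 + 1 / r x * (z x - r x * u.fn x) ^ 2)

/-- The constitutive relation error `E_CRE`, with `E_CRE² = ∫_I e_CRE² dt`. -/
def cre (k r : E d → ℝ) (u : Evolution Ω Γu T c) (q : L2Time T (L2Vec Ω))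
    (z : L2Time T (L2 Ω)) : ℝ :=
  Real.sqrt (∫ t, creSpaceSq k r (u.toFun t) (q t) (z t) ∂(timeMeasure T))

/-- The constitutive relation error is finite, where a quotient `a² / r` with `r = 0` counts as `0`
if `a = 0` and as `+∞` otherwise. Only the reaction part has to be mentioned, since the diffusion
part is finite as soon as `k` is bounded from below by a positive constant; the condition always
holds when `r` is bounded from below by a positive constant, and also when `ẑ = rû`. -/
structure HasFiniteCRE (r : E d → ℝ) (u : Evolution Ω Γu T c) (z : L2Time T (L2 Ω)) : Prop where
  zero_of_zero : ∀ᵐ t ∂(timeMeasure T), ∀ᵐ x ∂(volume.restrict Ω), r x = 0 → z t x = 0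
  integrable_space : ∀ᵐ t ∂(timeMeasure T),
    Integrable (fun x => 1 / r x * (z t x - r x * (u.toFun t).fn x) ^ 2) (volume.restrict Ω)
  integrable_time : Integrable
    (fun t => ∫ x in Ω, 1 / r x * (z t x - r x * (u.toFun t).fn x) ^ 2) (timeMeasure T)

/-- The correction term
`Q_corr = ∫_I ∫_Ω (1/k (q̂_m - k∇u_m) · q̃* + 1/r (ẑ_m - r u_m) z̃*)`, where
`(q̃*, z̃*) = 1/2 [(q̃, z̃) + (k∇ũ, rũ)]` is the averaged adjoint flux pair. -/
def Qcorr (k r : E d → ℝ) (u : Evolution Ω Γu T c) (q : L2Time T (L2Vec Ω)) (z : L2Time T (L2 Ω))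
    (ua : Evolution Ω Γu T c) (qa : L2Time T (L2Vec Ω)) (za : L2Time T (L2 Ω)) : ℝ :=
  ∫ t, (∫ x in Ω,
    (1 / k x * ⟪q t x - k x • (u.toFun t).grad x,
        (1 / 2 : ℝ) • (qa t x + k x • (ua.toFun t).grad x)⟫
      + 1 / r x * (z t x - r x * (u.toFun t).fn x)
        * (1 / 2 * (za t x + r x * (ua.toFun t).fn x)))) ∂(timeMeasure T)

/-- The difference of the two forms of the correction term,
`∫_I ∫_Ω (1/k (q̃ - k∇ũ) · (q̂* - k∇u_m) + 1/r (z̃ - rũ) (ẑ* - r u_m))`, where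
`(q̂*, ẑ*) = 1/2 [(q̂_m, ẑ_m) + (k∇u_m, r u_m)]` is the averaged primal flux pair. -/
def corrShift (k r : E d → ℝ) (u : Evolution Ω Γu T c) (q : L2Time T (L2Vec Ω))
    (z : L2Time T (L2 Ω)) (ua : Evolution Ω Γu T c) (qa : L2Time T (L2Vec Ω))
    (za : L2Time T (L2 Ω)) : ℝ :=
  ∫ t, (∫ x in Ω,
    (1 / k x * ⟪qa t x - k x • (ua.toFun t).grad x,
        (1 / 2 : ℝ) • (q t x + k x • (u.toFun t).grad x) - k x • (u.toFun t).grad x⟫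
      + 1 / r x * (za t x - r x * (ua.toFun t).fn x)
        * (1 / 2 * (z t x + r x * (u.toFun t).fn x) - r x * (u.toFun t).fn x))) ∂(timeMeasure T)

end ParabolicCRE

end

open ParabolicCRE

/-!
Write `S v = (√k ∇v, √r v)`, and let `A`, `A'` be the constitutive gaps of the primal and of the
adjoint triplet, scaled by `1 / √k` and `1 / √r`. Their norms are the two constitutive relation
errors, and equilibrium of the primal triplet turns the residual into `R(v) = ⟪A, S v⟫`. For the
error `e = u - u_m`, the difference of the two primal problems tested with `e` gives
`‖S e‖² ≤ ⟪A, S e⟫`, since the time derivative contributes `‖√c e(T)‖² / 2 ≥ 0`: so `S e` lies in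
the ball with centre `A / 2` and radius `‖A‖ / 2`. Integrating the time derivative by parts,
equilibrium of the adjoint triplet gives `ΔQ - R(ũ) = ⟪A', S e⟫`. Since
`Q_corr = R(ũ) + ⟪A', A / 2⟫`, the correction replaces `S e` by its deviation from that centre,
whence the factor `1 / 2`.

The functions of `W` are too irregular in time for these two facts on the time derivative to be
direct computations; they are obtained from the Steklov means `h⁻¹ ∫_{t-h}^t`, after extension by
zero to the real line.
-/

noncomputable section

namespace ParabolicCRE

open Filter

section TimeIntegration

theorem intervalIntegrable_of_memLp {p : ℝ≥0∞} {F : Type*} [NormedAddCommGroup F] {f : ℝ → F}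
    (hf : MemLp f p) (hp : 1 ≤ p) (x y : ℝ) : IntervalIntegrable f volume x y :=
  intervalIntegrable_iff.2 (((hf.locallyIntegrable hp).integrableOn_isCompact
    isCompact_uIcc).mono_set uIoc_subset_uIcc)

variable {α X Y : Type*} [MeasurableSpace α] {μ : Measure α} [NormedAddCommGroup X]
  [NormedSpace ℝ X] [NormedAddCommGroup Y] [NormedSpace ℝ Y]

theorem integrable_bilin (C : X →L[ℝ] Y →L[ℝ] ℝ) {u : α → X} {v : α → Y} (hu : MemLp u 2 μ)
    (hv : MemLp v 2 μ) : Integrable (fun t => C (u t) (v t)) μ :=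
  memLp_one_iff_integrable.1 (C.memLp_of_bilin (r := 1) hu hv)

theorem continuous_integral_bilin_translate (C : X →L[ℝ] Y →L[ℝ] ℝ) {f : ℝ → X} {v : ℝ → Y}
    (hf : MemLp f 2) (hv : MemLp v 2) : Continuous fun σ : ℝ => ∫ t, C (f (t - σ)) (v t) := by
  have : Fact ((2 : ℝ≥0∞) ≠ ⊤) := ⟨by simp⟩
  have hcont : Continuous fun σ : ℝ =>
      C.lpPairing volume 2 2 (DomAddAct.mk (-σ) +ᵥ hf.toLp f) (hv.toLp v) :=
    ((ContinuousLinearMap.continuous _).comp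
      ((DomAddAct.continuous_mk.comp continuous_neg).vadd continuous_const)).clm_apply
        continuous_const
  convert hcont using 2 with σ
  rw [ContinuousLinearMap.lpPairing_eq_integral]
  refine integral_congr_ae ?_
  filter_upwards [DomAddAct.vadd_Lp_ae_eq (DomAddAct.mk (-σ)) (hf.toLp f), hv.coeFn_toLp,
    (quasiMeasurePreserving_add_left volume (-σ)).ae hf.coeFn_toLp] with t htrans htv htf
  rw [htrans, htv, Equiv.symm_apply_apply, vadd_eq_add, htf, neg_add_eq_sub]

theorem hasDerivAt_integral_bilin_steklov [CompleteSpace X] (C : X →L[ℝ] Y →L[ℝ] ℝ)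
    {f : ℝ → X} {v : ℝ → Y} (hf : MemLp f 2) (hv : MemLp v 2) :
    HasDerivAt (fun h : ℝ => ∫ t, C (∫ s in (t - h)..t, f s) (v t)) (∫ t, C (f t) (v t)) 0 := by
  have hcont := continuous_integral_bilin_translate C hf hv
  have hderiv : HasDerivAt (fun h : ℝ => ∫ σ in (0 : ℝ)..h, ∫ t, C (f (t - σ)) (v t))
      (∫ t, C (f (t - 0)) (v t)) 0 :=
    intervalIntegral.integral_hasDerivAt_right (by simp) (hcont.stronglyMeasurableAtFilter _ _)
      hcont.continuousAt
  simp only [sub_zero] at hderiv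
  convert hderiv using 2 with h
  have : IsFiniteMeasure (volume.restrict (uIoc 0 h)) := ⟨by simp [uIoc]⟩
  have hprod : Integrable (fun p : ℝ × ℝ => C (f (p.2 - p.1)) (v p.2))
      ((volume.restrict (uIoc 0 h)).prod volume) := by
    refine integrable_bilin C ?_ (hv.comp_snd _)
    simpa only [Function.comp_def, neg_add_eq_sub] using
      (hf.comp_snd (volume.restrict (uIoc 0 h))).comp_measurePreserving
        (measurePreserving_prod_neg_add (volume.restrict (uIoc 0 h)) volume)
  rw [intervalIntegral_integral_swap hprod]
  refine integral_congr_ae (Eventually.of_forall fun t => ?_)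
  have hshift : ∫ σ in (0 : ℝ)..h, f (t - σ) = ∫ s in (t - h)..t, f s := by
    rw [intervalIntegral.integral_comp_sub_left, sub_zero]
  have hfti : IntervalIntegrable (fun σ => f (t - σ)) volume 0 h :=
    intervalIntegrable_of_memLp
      (hf.comp_measurePreserving (Measure.measurePreserving_sub_left volume t)) one_le_two 0 h
  simpa only [hshift, ContinuousLinearMap.flip_apply] using
    ((C.flip (v t)).intervalIntegral_comp_comm hfti).symm

variable {C : X →L[ℝ] StrongDual ℝ X} {J : Set ℝ} {a b t₀ : ℝ} {u v : ℝ → X}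
  {f g : ℝ → StrongDual ℝ X}

/-- The function `C u` has the time derivative `f` on `J` and vanishes at the time `t₀`, where
`u` and `f` are square integrable. A problem forward in time has `J = Iic b` and `t₀ = a`, a
problem backward in time has `J = Ici a` and `t₀ = b`. -/
structure IsPrimitiveOn (C : X →L[ℝ] StrongDual ℝ X) (J : Set ℝ) (t₀ : ℝ) (u : ℝ → X)
    (f : ℝ → StrongDual ℝ X) : Prop where
  memLp : MemLp u 2
  memLp_deriv : MemLp f 2
  eq_integral : ∀ᵐ t, t ∈ J → C (u t) = ∫ s in t₀..t, f s

theorem IsPrimitiveOn.sub (hu : IsPrimitiveOn C J t₀ u f) (hv : IsPrimitiveOn C J t₀ v g) :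
    IsPrimitiveOn C J t₀ (u - v) (f - g) where
  memLp := hu.memLp.sub hv.memLp
  memLp_deriv := hu.memLp_deriv.sub hv.memLp_deriv
  eq_integral := by
    filter_upwards [hu.eq_integral, hv.eq_integral] with t hut hvt ht
    rw [Pi.sub_apply, map_sub, hut ht, hvt ht]
    exact (intervalIntegral.integral_sub (intervalIntegrable_of_memLp hu.memLp_deriv one_le_two _ _)
      (intervalIntegrable_of_memLp hv.memLp_deriv one_le_two _ _)).symm

theorem IsPrimitiveOn.integral_steklov (hu : IsPrimitiveOn C J t₀ u f) (hv : MemLp v 2)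
    (h : ℝ) (hvJ : ∀ t ∈ Function.support v, t ∈ J ∧ t - h ∈ J) :
    ∫ t, (∫ s in (t - h)..t, f s) (v t)
      = (∫ t, C (u t) (v t)) - ∫ t, C (u (t - h)) (v t) := by
  have hmp := measurePreserving_sub_right (volume : Measure ℝ) h
  have hfi := intervalIntegrable_of_memLp hu.memLp_deriv one_le_two
  have hu' : MemLp (fun t => u (t - h)) 2 := hu.memLp.comp_measurePreserving hmp
  rw [← integral_sub (integrable_bilin C hu.memLp hv) (integrable_bilin C hu' hv)]
  refine integral_congr_ae ?_
  filter_upwards [hu.eq_integral, hmp.quasiMeasurePreserving.ae hu.eq_integral] with t ht htsub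
  by_cases hvt : v t = 0
  · simp [hvt]
  · rw [ht (hvJ t hvt).1, htsub (hvJ t hvt).2, ← sub_apply,
      intervalIntegral.integral_interval_sub_left (hfi _ _) (hfi _ _)]

theorem IsPrimitiveOn.integral_add_integral_eq_zero (hC : ∀ x y, C x y = C y x)
    (hu : IsPrimitiveOn C (Iic b) a u f) (hv : IsPrimitiveOn C (Ici a) b v g)
    (hus : Function.support u ⊆ Icc a b) (hvs : Function.support v ⊆ Icc a b) :
    (∫ t, f t (v t)) + ∫ t, g t (u t) = 0 := by
  have hforward := (hasDerivAt_integral_bilin_steklov (ContinuousLinearMap.id ℝ _)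
    hu.memLp_deriv hv.memLp).hasDerivWithinAt (s := Ici 0)
  have hbackward := hasDerivAt_integral_bilin_steklov (ContinuousLinearMap.id ℝ _)
    hv.memLp_deriv hu.memLp
  have hreflect := (hbackward.scomp_of_eq (0 : ℝ) (hasDerivAt_neg 0)
    neg_zero.symm).hasDerivWithinAt (s := Ici 0)
  have heq : ∀ h ∈ Ici (0 : ℝ), (∫ t, (∫ s in (t - h)..t, f s) (v t))
      = ∫ t, (∫ s in (t - -h)..t, g s) (u t) := by
    intro h (hh : 0 ≤ h)
    rw [hu.integral_steklov hv.memLp h fun t ht =>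
        ⟨(hvs ht).2, show t - h ≤ b by linarith [(hvs ht).2]⟩,
      hv.integral_steklov hu.memLp (-h) fun t ht =>
        ⟨(hus ht).1, show a ≤ t - -h by linarith [(hus ht).1]⟩,
      ← integral_add_right_eq_self (fun t => C (u (t - h)) (v t)) h]
    simp only [hC, add_sub_cancel_right, sub_neg_eq_add]
  have hderiv : ∫ t, f t (v t) = (-1 : ℝ) • ∫ t, g t (u t) :=
    (uniqueDiffWithinAt_Ici (0 : ℝ)).eq_deriv _ hforward (hreflect.congr heq (heq 0 self_mem_Ici))
  rw [hderiv, neg_one_smul, neg_add_cancel]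

theorem integral_bilin_translate_le (hC : ∀ x y, C x y = C y x) (hpos : ∀ x, 0 ≤ C x x)
    (hu : MemLp u 2) (h : ℝ) : ∫ t, C (u (t - h)) (u t) ≤ ∫ t, C (u t) (u t) := by
  have hu' : MemLp (fun t => u (t - h)) 2 :=
    hu.comp_measurePreserving (measurePreserving_sub_right volume h)
  have hmean : ∫ t, C (u (t - h)) (u t)
      ≤ ∫ t, (1 / 2 * C (u t) (u t) + 1 / 2 * C (u (t - h)) (u (t - h))) := by
    refine integral_mono (integrable_bilin C hu' hu)
      (((integrable_bilin C hu hu).const_mul _).add ((integrable_bilin C hu' hu').const_mul _))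
      fun t => ?_
    have := hpos (u t - u (t - h))
    simp only [map_sub, sub_apply, hC (u t) (u (t - h))] at this
    linarith
  rw [integral_add ((integrable_bilin C hu hu).const_mul _)
    ((integrable_bilin C hu' hu').const_mul _), integral_const_mul, integral_const_mul,
    integral_sub_right_eq_self (fun t => C (u t) (u t)) h] at hmean
  linarith

theorem IsPrimitiveOn.integral_nonneg (hC : ∀ x y, C x y = C y x) (hpos : ∀ x, 0 ≤ C x x)
    (hu : IsPrimitiveOn C (Iic b) a u f) (hus : Function.support u ⊆ Iic b) :
    0 ≤ ∫ t, f t (u t) := by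
  have hslope := (hasDerivAt_integral_bilin_steklov (ContinuousLinearMap.id ℝ _)
    hu.memLp_deriv hu.memLp).hasDerivWithinAt (s := Ioi 0)
  rw [hasDerivWithinAt_iff_tendsto_slope' self_notMem_Ioi] at hslope
  refine ge_of_tendsto hslope ?_
  filter_upwards [self_mem_nhdsWithin] with h (hh : 0 < h)
  simp only [slope, vsub_eq_sub, sub_zero, smul_eq_mul, ContinuousLinearMap.id_apply,
    intervalIntegral.integral_same, zero_apply, integral_zero]
  rw [hu.integral_steklov hu.memLp h fun t ht => ⟨hus ht, (sub_le_self t hh.le).trans (hus ht)⟩]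
  exact mul_nonneg (inv_nonneg.2 hh.le)
    (sub_nonneg.2 (integral_bilin_translate_le hC hpos hu.memLp h))

end TimeIntegration

section WeakDerivative

theorem exists_subset_Icc_of_isCompact_subset_Ioo {α : Type*} [LinearOrder α] [TopologicalSpace α]
    [OrderClosedTopology α] [NoMinOrder α] [NoMaxOrder α] {K : Set α} {a b : α} (hK : IsCompact K)
    (hKab : K ⊆ Ioo a b) : ∃ a' b', a < a' ∧ b' < b ∧ K ⊆ Icc a' b' := by
  rcases K.eq_empty_or_nonempty with rfl | hne
  · obtain ⟨a', ha'⟩ := exists_gt a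
    obtain ⟨b', hb'⟩ := exists_lt b
    exact ⟨a', b', ha', hb', empty_subset _⟩
  · obtain ⟨a', ha'K, ha'⟩ := hK.exists_isLeast hne
    obtain ⟨b', hb'K, hb'⟩ := hK.exists_isGreatest hne
    exact ⟨a', b', (hKab ha'K).1, (hKab hb'K).2, fun x hx => ⟨ha' hx, hb' hx⟩⟩

/-- Smooth functions with compact support in the open interval `(a, b)`, the test functions of
distributional derivatives. -/
structure IsTestFunction (a b : ℝ) (φ : ℝ → ℝ) : Prop where
  contDiff : ContDiff ℝ ∞ φ
  hasCompactSupport : HasCompactSupport φ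
  tsupport_subset : tsupport φ ⊆ Ioo a b

/-- `g` is the derivative of `F` in the sense of distributions on `(a, b)`. -/
def HasWeakDeriv (a b : ℝ) (F g : ℝ → ℝ) : Prop :=
  ∀ φ, IsTestFunction a b φ → ∫ t in Icc a b, deriv φ t * F t = -∫ t in Icc a b, φ t * g t

variable {a b : ℝ} {φ ψ F g : ℝ → ℝ}

theorem IsTestFunction.sub (hφ : IsTestFunction a b φ) (hψ : IsTestFunction a b ψ) :
    IsTestFunction a b (φ - ψ) where
  contDiff := hφ.contDiff.sub hψ.contDiff
  hasCompactSupport := hφ.hasCompactSupport.sub hψ.hasCompactSupport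
  tsupport_subset :=
    (tsupport_sub _ _).trans (union_subset hφ.tsupport_subset hψ.tsupport_subset)

theorem IsTestFunction.const_smul (hφ : IsTestFunction a b φ) (K : ℝ) :
    IsTestFunction a b (K • φ) where
  contDiff := contDiff_const.smul hφ.contDiff
  hasCompactSupport := hφ.hasCompactSupport.smul_left (f := fun _ => K)
  tsupport_subset := (closure_mono (Function.support_const_smul_subset K φ)).trans
    hφ.tsupport_subset

theorem IsTestFunction.apply_eq_zero (hφ : IsTestFunction a b φ) {t : ℝ} (ht : t ∉ Ioo a b) :
    φ t = 0 :=
  image_eq_zero_of_notMem_tsupport fun h => ht (hφ.tsupport_subset h)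

theorem IsTestFunction.setIntegral_Icc (hφ : IsTestFunction a b φ) :
    ∫ t in Icc a b, φ t = ∫ t, φ t :=
  setIntegral_eq_integral_of_forall_compl_eq_zero fun _ ht =>
    hφ.apply_eq_zero fun h => ht (Ioo_subset_Icc_self h)

theorem exists_isTestFunction_integral_eq_one (hab : a < b) :
    ∃ η, IsTestFunction a b η ∧ ∫ t, η t = 1 := by
  let B : ContDiffBump ((a + b) / 2) := ⟨(b - a) / 8, (b - a) / 4, by linarith, by linarith⟩
  refine ⟨B.normed volume, ⟨B.contDiff_normed, B.hasCompactSupport_normed, ?_⟩, B.integral_normed⟩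
  rw [B.tsupport_normed_eq, Real.closedBall_eq_Icc]
  exact Icc_subset_Ioo (by change a < (a + b) / 2 - (b - a) / 4; linarith)
    (by change (a + b) / 2 + (b - a) / 4 < b; linarith)

theorem IsTestFunction.exists_primitive (hψ : IsTestFunction a b ψ) (h0 : ∫ t, ψ t = 0) :
    ∃ φ, IsTestFunction a b φ ∧ deriv φ = ψ := by
  have hcont := hψ.contDiff.continuous
  have hderiv (t : ℝ) : HasDerivAt (fun x => ∫ s in a..x, ψ s) (ψ t) t :=
    intervalIntegral.integral_hasDerivAt_right (hcont.intervalIntegrable _ _)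
      (hcont.stronglyMeasurableAtFilter _ _) hcont.continuousAt
  have hderiv_eq : deriv (fun x => ∫ s in a..x, ψ s) = ψ := funext fun t => (hderiv t).deriv
  obtain ⟨a', b', ha', hb', hsub⟩ :=
    exists_subset_Icc_of_isCompact_subset_Ioo hψ.hasCompactSupport hψ.tsupport_subset
  have hzero {t : ℝ} (ht : t ∉ Icc a' b') : ψ t = 0 :=
    image_eq_zero_of_notMem_tsupport fun h => ht (hsub h)
  have hsupport : Function.support (fun x => ∫ s in a..x, ψ s) ⊆ Icc a' b' := by
    refine fun x hx => by_contra fun hxab => hx ?_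
    rcases lt_or_ge x a' with hxa | hxa
    · refine intervalIntegral.integral_zero_ae (Eventually.of_forall fun t ht => hzero fun h => ?_)
      exact (h.1.trans ht.2).not_gt (max_lt ha' hxa)
    · have hbx : b' < x := lt_of_not_ge fun h => hxab ⟨hxa, h⟩
      beta_reduce
      rw [intervalIntegral.integral_of_le (ha'.le.trans hxa),
        setIntegral_eq_integral_of_forall_compl_eq_zero, h0]
      exact fun t ht => hzero fun h => ht ⟨ha'.trans_le h.1, h.2.trans hbx.le⟩
  have htsupport := closure_minimal hsupport isClosed_Icc
  refine ⟨_, ⟨contDiff_infty_iff_deriv.2 ⟨fun t => (hderiv t).differentiableAt, ?_⟩,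
    isCompact_Icc.of_isClosed_subset (isClosed_tsupport _) htsupport,
    htsupport.trans (Icc_subset_Ioo ha' hb')⟩, hderiv_eq⟩
  rw [hderiv_eq]
  exact hψ.contDiff

theorem HasWeakDeriv.ae_eq_const (hab : a < b) (hF : IntegrableOn F (Icc a b))
    (h : HasWeakDeriv a b F 0) : ∃ K : ℝ, ∀ᵐ t ∂volume.restrict (Icc a b), F t = K := by
  obtain ⟨η, hη, hη1⟩ := exists_isTestFunction_integral_eq_one hab
  have hint {ψ : ℝ → ℝ} (hψ : IsTestFunction a b ψ) :
      IntegrableOn (fun t => ψ t * F t) (Icc a b) :=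
    hF.continuousOn_mul hψ.contDiff.continuous.continuousOn isCompact_Icc
  have hint' {ψ : ℝ → ℝ} (hψ : IsTestFunction a b ψ) : Integrable ψ :=
    hψ.contDiff.continuous.integrable_of_hasCompactSupport hψ.hasCompactSupport
  refine ⟨∫ t in Icc a b, η t * F t, ?_⟩
  set K := ∫ t in Icc a b, η t * F t
  have hae : ∀ᵐ t ∂volume.restrict (Icc a b), t ∈ Ioo a b → F t - K = 0 := by
    refine isOpen_Ioo.ae_eq_zero_of_integral_contDiff_smul_eq_zero
      ((hF.sub (integrable_const K)).locallyIntegrable.locallyIntegrableOn _) ?_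
    intro ψ hψs hψc hψsub
    have hψ : IsTestFunction a b ψ := ⟨hψs, hψc, hψsub⟩
    have hmean : ∫ t, (ψ - (∫ s, ψ s) • η) t = 0 := by
      simp only [Pi.sub_apply, Pi.smul_apply, smul_eq_mul]
      rw [integral_sub (hint' hψ) ((hint' hη).const_mul _), integral_const_mul, hη1, mul_one,
        sub_self]
    obtain ⟨φ, hφ, hφψ⟩ := (hψ.sub (hη.const_smul _)).exists_primitive hmean
    have horth := h φ hφ
    simp only [hφψ, Pi.sub_apply, Pi.smul_apply, smul_eq_mul, sub_mul, mul_assoc, Pi.zero_apply,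
      mul_zero, integral_zero, neg_zero] at horth
    rw [integral_sub (hint hψ) ((hint hη).const_mul _), integral_const_mul] at horth
    simp only [smul_eq_mul, mul_sub]
    rwa [integral_sub (hint hψ) ((hint' hψ).integrableOn.mul_const K), integral_mul_const,
      hψ.setIntegral_Icc]
  rw [← restrict_Ioo_eq_restrict_Icc] at hae ⊢
  filter_upwards [hae, ae_restrict_mem measurableSet_Ioo] with t ht htab
  exact sub_eq_zero.1 (ht htab)

theorem hasWeakDeriv_intervalIntegral (hab : a ≤ b) (hg : IntegrableOn g (Icc a b)) :
    HasWeakDeriv a b (fun t => ∫ s in a..t, g s) g := by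
  intro φ hφ
  have hgi : IntervalIntegrable g volume a b :=
    (intervalIntegrable_iff_integrableOn_Icc_of_le hab).2 hg
  have hparts := ((hφ.contDiff.of_le (by simp)).contDiffOn.absolutelyContinuousOnInterval
    (a := a) (b := b)).integral_mul_deriv_eq_deriv_mul
      (hgi.absolutelyContinuousOnInterval_intervalIntegral left_mem_uIcc)
  have hderiv :
      ∫ t in a..b, φ t * deriv (fun x => ∫ s in a..x, g s) t = ∫ t in a..b, φ t * g t := by
    refine intervalIntegral.integral_congr_ae ?_
    filter_upwards [hgi.ae_hasDerivAt_integral] with t ht htab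
    rw [(ht (uIoc_subset_uIcc htab) a left_mem_uIcc).deriv]
  rw [hderiv, hφ.apply_eq_zero left_notMem_Ioo, hφ.apply_eq_zero right_notMem_Ioo, zero_mul,
    zero_mul, sub_zero, zero_sub, intervalIntegral.integral_of_le hab,
    intervalIntegral.integral_of_le hab,
    ← integral_Icc_eq_integral_Ioc, ← integral_Icc_eq_integral_Ioc] at hparts
  rw [hparts, neg_neg]

theorem HasWeakDeriv.sub_eq_integral (hab : a < b) (hF : ContinuousOn F (Icc a b))
    (hg : IntegrableOn g (Icc a b)) (h : HasWeakDeriv a b F g) {s t : ℝ} (hs : s ∈ Icc a b)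
    (ht : t ∈ Icc a b) : F t - F s = ∫ x in s..t, g x := by
  have hgi (x y : ℝ) (hx : x ∈ Icc a b) (hy : y ∈ Icc a b) : IntervalIntegrable g volume x y :=
    (hg.mono_set (uIcc_subset_Icc hx hy)).intervalIntegrable
  have hG : ContinuousOn (fun t => ∫ s in a..t, g s) (Icc a b) :=
    intervalIntegral.continuousOn_primitive_interval (by rwa [uIcc_of_le hab.le])|>.mono
      (by rw [uIcc_of_le hab.le])
  obtain ⟨K, hK⟩ := HasWeakDeriv.ae_eq_const hab (hF.sub hG).integrableOn_Icc fun φ hφ => by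
    have hφ' : Continuous (deriv φ) := hφ.contDiff.continuous_deriv (by simp)
    have hiF : IntegrableOn (fun t => deriv φ t * F t) (Icc a b) :=
      (hφ'.continuousOn.mul hF).integrableOn_Icc
    have hiG : IntegrableOn (fun t => deriv φ t * ∫ s in a..t, g s) (Icc a b) :=
      (hφ'.continuousOn.mul hG).integrableOn_Icc
    simp only [Pi.sub_apply, mul_sub]
    rw [integral_sub hiF hiG, h φ hφ,
      hasWeakDeriv_intervalIntegral hab.le hg φ hφ]
    simp
  have hconst := Measure.eqOn_Icc_of_ae_eq volume hab.ne hK (hF.sub hG) continuousOn_const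
  have hFs := hconst hs
  have hFt := hconst ht
  simp only [Pi.sub_apply] at hFs hFt
  rw [← intervalIntegral.integral_interval_sub_left (hgi a t ⟨le_rfl, hab.le⟩ ht)
    (hgi a s ⟨le_rfl, hab.le⟩ hs)]
  linarith

end WeakDerivative

section WeightedL2

variable {α β F : Type*} [MeasurableSpace α] [MeasurableSpace β] {μ : Measure α} {ν : Measure β}
  [NormedAddCommGroup F]

theorem tendsto_Lp_of_dominated {p : ℝ≥0∞} [Fact (1 ≤ p)] (hp : p ≠ ⊤) {f : ℕ → Lp F p μ}
    {g : Lp F p μ} {bound : α → ℝ} (hbound : MemLp bound p μ)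
    (hf : ∀ n, ∀ᵐ x ∂μ, ‖f n x - g x‖ ≤ bound x)
    (hlim : ∀ᵐ x ∂μ, Tendsto (fun n => f n x) atTop (𝓝 (g x))) : Tendsto f atTop (𝓝 g) := by
  have hp0 : p ≠ 0 := (zero_lt_one.trans_le Fact.out).ne'
  have hp_pos : 0 < p.toReal := ENNReal.toReal_pos hp0 hp
  rw [Lp.tendsto_Lp_iff_tendsto_eLpNorm']
  simp only [eLpNorm_eq_lintegral_rpow_enorm_toReal hp0 hp]
  have hlintegral : Tendsto (fun n => ∫⁻ x, ‖(⇑(f n) - ⇑g) x‖ₑ ^ p.toReal ∂μ) atTop (𝓝 0) := by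
    rw [← lintegral_zero (μ := μ)]
    refine tendsto_lintegral_of_dominated_convergence' (fun x => ‖bound x‖ₑ ^ p.toReal)
      (fun n => ?_) (fun n => ?_) (lintegral_rpow_enorm_lt_top_of_eLpNorm_lt_top hp0 hp
        hbound.2).ne ?_
    · exact (((Lp.memLp (f n)).sub (Lp.memLp g)).aestronglyMeasurable.enorm).pow_const _
    · filter_upwards [hf n] with x hx
      gcongr
      exact enorm_le_iff_norm_le.2 (hx.trans (le_abs_self _))
    · filter_upwards [hlim] with x hx
      simpa [ENNReal.zero_rpow_of_pos hp_pos] using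
        (((hx.sub_const (g x)).enorm).ennrpow_const p.toReal)
  simpa [ENNReal.zero_rpow_of_pos (inv_pos.2 hp_pos)] using hlintegral.ennrpow_const (1 / p.toReal)

theorem coeFn_coeFn_add (a b : Lp (Lp F 2 μ) 2 ν) :
    ∀ᵐ t ∂ν, (a + b) t =ᵐ[μ] a t + b t := by
  filter_upwards [Lp.coeFn_add a b] with t ht
  rw [ht]
  exact Lp.coeFn_add (a t) (b t)

theorem coeFn_coeFn_sub (a b : Lp (Lp F 2 μ) 2 ν) :
    ∀ᵐ t ∂ν, (a - b) t =ᵐ[μ] a t - b t := by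
  filter_upwards [Lp.coeFn_sub a b] with t ht
  rw [ht]
  exact Lp.coeFn_sub (a t) (b t)

variable [InnerProductSpace ℝ F] {m : α → ℝ}

theorem coeFn_coeFn_smul (s : ℝ)
    (a : Lp (Lp F 2 μ) 2 ν) : ∀ᵐ t ∂ν, (s • a) t =ᵐ[μ] s • a t := by
  filter_upwards [Lp.coeFn_smul s a] with t ht
  rw [ht]
  exact Lp.coeFn_smul s (a t)

theorem memLp_top_sqrt (hm : MemLp m ∞ μ) : MemLp (fun x => √(m x)) ∞ μ := by
  refine memLp_top_of_bound hm.aestronglyMeasurable.aemeasurable.sqrt.aestronglyMeasurable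
    √(eLpNormEssSup m μ).toReal ?_
  have hbound : eLpNormEssSup m μ ≠ ⊤ := by
    rw [← eLpNorm_exponent_top]
    exact hm.2.ne
  filter_upwards [enorm_ae_le_eLpNormEssSup m μ] with x hx
  rw [Real.norm_of_nonneg (Real.sqrt_nonneg _)]
  refine Real.sqrt_le_sqrt ((le_abs_self _).trans ?_)
  rw [← Real.norm_eq_abs, ← toReal_enorm]
  exact ENNReal.toReal_mono hbound hx

/-- Multiplication by an essentially bounded function, as a bounded operator on `L²`. -/
def weightL (F : Type*) [NormedAddCommGroup F] [InnerProductSpace ℝ F] (hm : MemLp m ∞ μ) :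
    Lp F 2 μ →L[ℝ] Lp F 2 μ :=
  (ContinuousLinearMap.lsmul ℝ ℝ).holderL μ ∞ 2 2 (hm.toLp m)

theorem coeFn_weightL (hm : MemLp m ∞ μ) (a : Lp F 2 μ) :
    weightL F hm a =ᵐ[μ] fun x => m x • a x := by
  have hholder := (ContinuousLinearMap.lsmul ℝ ℝ).coeFn_holder (r := 2) (hm.toLp m) a
  filter_upwards [hholder, hm.coeFn_toLp] with x hx hmx
  rw [weightL, ContinuousLinearMap.holderL_apply_apply, hx, hmx, ContinuousLinearMap.lsmul_apply]

theorem aestronglyMeasurable_of_ae_eq_smul (hm : AEMeasurable m μ) {a A : β → Lp F 2 μ}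
    (ha : AEStronglyMeasurable a ν) (hA : ∀ᵐ t ∂ν, A t =ᵐ[μ] fun x => m x • a t x) :
    AEStronglyMeasurable A ν := by
  let trunc (n : ℕ) : ℝ → ℝ := (Icc (-n : ℝ) n).indicator id
  have htrunc (n : ℕ) : MemLp (trunc n ∘ m) ∞ μ := by
    refine memLp_top_of_bound ((measurable_id.indicator measurableSet_Icc).comp_aemeasurable
      hm).aestronglyMeasurable n (Eventually.of_forall fun x => ?_)
    by_cases hx : m x ∈ Icc (-n : ℝ) n
    · simpa [trunc, hx] using abs_le.2 hx
    · simp [trunc, hx]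
  refine aestronglyMeasurable_of_tendsto_ae atTop (f := fun n t => weightL F (htrunc n) (a t))
    (fun n => (weightL F (htrunc n)).continuous.comp_aestronglyMeasurable ha) ?_
  filter_upwards [hA] with t ht
  have hcoe := ae_all_iff.2 fun n => coeFn_weightL (htrunc n) (a t)
  refine tendsto_Lp_of_dominated ENNReal.ofNat_ne_top (Lp.memLp (A t)).norm (fun n => ?_) ?_
  · filter_upwards [hcoe, ht] with x hx hAx
    rw [hx n, hAx]
    by_cases hmx : m x ∈ Icc (-n : ℝ) n <;> simp [trunc, hmx]
  · filter_upwards [hcoe, ht] with x hx hAx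
    obtain ⟨N, hN⟩ := exists_nat_ge |m x|
    refine tendsto_const_nhds.congr' ?_
    filter_upwards [eventually_ge_atTop N] with n hn
    have hmx : m x ∈ Icc (-n : ℝ) n := abs_le.1 (hN.trans (by exact_mod_cast hn))
    simp [hx n, hAx, trunc, hmx]

theorem coeFn_compLp_weightL {X : Type*} [NormedAddCommGroup X] [NormedSpace ℝ X] (hm : MemLp m ∞ μ)
    (L : X →L[ℝ] Lp F 2 μ) (v : Lp X 2 ν) :
    ∀ᵐ t ∂ν, (weightL F hm ∘L L).compLp v t =ᵐ[μ] fun x => m x • L (v t) x := by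
  filter_upwards [(weightL F hm ∘L L).coeFn_compLp v] with t ht
  rw [ht]
  exact coeFn_weightL hm (L (v t))

theorem coeFn_sub_compLp_weightL {X : Type*} [NormedAddCommGroup X] [NormedSpace ℝ X]
    (hm : MemLp m ∞ μ) (L : X →L[ℝ] Lp F 2 μ) (a : Lp (Lp F 2 μ) 2 ν) (v : Lp X 2 ν) :
    ∀ᵐ t ∂ν, (a - (weightL F hm ∘L L).compLp v) t =ᵐ[μ] fun x => a t x - m x • L (v t) x := by
  filter_upwards [coeFn_coeFn_sub a ((weightL F hm ∘L L).compLp v), coeFn_compLp_weightL hm L v]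
    with t hsub hweight
  filter_upwards [hsub, hweight] with x hsub hweight
  rw [hsub, Pi.sub_apply, hweight]

/-- The function `A` is the quotient of `a` by `√m`, with the value `0` where `m` vanishes; in
particular `a` has to vanish there. -/
def IsSqrtQuotient (μ : Measure α) (m : α → ℝ) (a A : α → F) : Prop :=
  ∀ᵐ x ∂μ, a x = √(m x) • A x ∧ (m x = 0 → A x = 0)

theorem inv_mul_inner_sqrt_smul {s : ℝ} (hs : 0 ≤ s) {a : F} (ha : s = 0 → a = 0) (b : F) :
    1 / s * ⟪√s • a, √s • b⟫ = ⟪a, b⟫ := by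
  rcases eq_or_ne s 0 with h0 | h0
  · simp [ha h0]
  · rw [real_inner_smul_left, real_inner_smul_right, ← mul_assoc √s, Real.mul_self_sqrt hs,
      ← mul_assoc, one_div_mul_cancel h0, one_mul]

theorem memLp_inv_sqrt_smul (hm : AEMeasurable m μ) (hm0 : ∀ᵐ x ∂μ, 0 ≤ m x) {a : α → F}
    (ha : AEStronglyMeasurable a μ) (hint : Integrable (fun x => 1 / m x * ‖a x‖ ^ 2) μ) :
    MemLp (fun x => (√(m x))⁻¹ • a x) 2 μ := by
  have hmeas : AEStronglyMeasurable (fun x => (√(m x))⁻¹ • a x) μ :=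
    hm.sqrt.inv.aestronglyMeasurable.smul ha
  rw [memLp_two_iff_integrable_sq_norm hmeas]
  refine hint.congr ?_
  filter_upwards [hm0] with x hx
  rw [norm_smul, mul_pow, norm_inv, Real.norm_of_nonneg (Real.sqrt_nonneg _), inv_pow,
    Real.sq_sqrt hx, one_div]

theorem exists_isSqrtQuotient_of_integrable (hm : AEMeasurable m μ) (hm0 : ∀ᵐ x ∂μ, 0 ≤ m x)
    (a : Lp (Lp F 2 μ) 2 ν) (hzero : ∀ᵐ t ∂ν, ∀ᵐ x ∂μ, m x = 0 → a t x = 0)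
    (hspace : ∀ᵐ t ∂ν, Integrable (fun x => 1 / m x * ‖a t x‖ ^ 2) μ)
    (htime : Integrable (fun t => ∫ x, 1 / m x * ‖a t x‖ ^ 2 ∂μ) ν) :
    ∃ A : Lp (Lp F 2 μ) 2 ν, ∀ᵐ t ∂ν, IsSqrtQuotient μ m (a t) (A t) := by
  have hmem : ∀ᵐ t ∂ν, MemLp (fun x => (√(m x))⁻¹ • a t x) 2 μ := by
    filter_upwards [hspace] with t ht
    exact memLp_inv_sqrt_smul hm hm0 (Lp.aestronglyMeasurable _) ht
  obtain ⟨A, hA⟩ : ∃ A : β → Lp F 2 μ, ∀ᵐ t ∂ν, A t =ᵐ[μ] fun x => (√(m x))⁻¹ • a t x := by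
    classical
    refine ⟨fun t => if h : MemLp (fun x => (√(m x))⁻¹ • a t x) 2 μ then h.toLp _ else 0, ?_⟩
    filter_upwards [hmem] with t ht
    rw [dif_pos ht]
    exact ht.coeFn_toLp
  have hquot : ∀ᵐ t ∂ν, IsSqrtQuotient μ m (a t) (A t) := by
    filter_upwards [hA, hzero] with t hAt hzt
    filter_upwards [hAt, hzt, hm0] with x hAx hzx hmx
    refine ⟨?_, fun h0 => by rw [hAx, h0, Real.sqrt_zero, inv_zero, zero_smul]⟩
    rcases hmx.eq_or_lt with h0 | hpos
    · rw [hzx h0.symm, hAx, hzx h0.symm, smul_zero, smul_zero]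
    · rw [hAx, smul_inv_smul₀ (Real.sqrt_pos.2 hpos).ne']
  have hAmem : MemLp A 2 ν := by
    rw [memLp_two_iff_integrable_sq_norm (aestronglyMeasurable_of_ae_eq_smul hm.sqrt.inv
      (Lp.aestronglyMeasurable a) hA)]
    refine htime.congr ?_
    filter_upwards [hquot] with t ht
    rw [← real_inner_self_eq_norm_sq, L2.inner_def]
    refine integral_congr_ae ?_
    filter_upwards [ht, hm0] with x hx hmx
    rw [← real_inner_self_eq_norm_sq, hx.1, inv_mul_inner_sqrt_smul hmx hx.2]
  refine ⟨hAmem.toLp A, ?_⟩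
  filter_upwards [hAmem.coeFn_toLp, hquot] with t ht hqt
  rwa [ht]

theorem exists_isSqrtQuotient_of_bounded_below (hm : AEMeasurable m μ) {m₀ : ℝ} (hm₀ : 0 < m₀)
    (hle : ∀ᵐ x ∂μ, m₀ ≤ m x) (a : Lp (Lp F 2 μ) 2 ν) :
    ∃ A : Lp (Lp F 2 μ) 2 ν, ∀ᵐ t ∂ν, IsSqrtQuotient μ m (a t) (A t) := by
  have hmem : MemLp (fun x => (√(m x))⁻¹) ∞ μ := by
    refine memLp_top_of_bound hm.sqrt.inv.aestronglyMeasurable (√m₀)⁻¹ ?_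
    filter_upwards [hle] with x hx
    rw [norm_inv, Real.norm_of_nonneg (Real.sqrt_nonneg _)]
    gcongr
  refine ⟨(weightL F hmem).compLp a, ?_⟩
  filter_upwards [(weightL F hmem).coeFn_compLp a] with t ht
  filter_upwards [coeFn_weightL hmem (a t), hle] with x hx hmx
  have hpos : 0 < m x := hm₀.trans_le hmx
  refine ⟨?_, fun h0 => absurd h0 hpos.ne'⟩
  rw [ht, hx, smul_inv_smul₀ (Real.sqrt_pos.2 hpos).ne']

end WeightedL2

section TimeDerivative

variable {d : ℕ} {Ω Γu : Set (E d)} {T : ℝ} {c : E d → ℝ}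

instance (T : ℝ) : IsFiniteMeasure (timeMeasure T) :=
  inferInstanceAs (IsFiniteMeasure (volume.restrict (Icc 0 T)))

theorem integral_indicator_apply {X : Type*} [NormedAddCommGroup X] [NormedSpace ℝ X]
    (f : ℝ → StrongDual ℝ X) (v : ℝ → X) :
    ∫ t, (Icc 0 T).indicator f t ((Icc 0 T).indicator v t) = ∫ t, f t (v t) ∂(timeMeasure T) := by
  rw [timeMeasure, ← integral_indicator measurableSet_Icc]
  refine integral_congr_ae (Eventually.of_forall fun t => ?_)
  by_cases ht : t ∈ Icc 0 T <;> simp [ht]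

/-- The continuous linear map `v ↦ v` from `𝒱` to `L²(Ω)`. -/
def V.fnL (Ω Γu : Set (E d)) : V Ω Γu →L[ℝ] L2 Ω :=
  WithLp.fstL 2 ℝ (L2 Ω) (L2Vec Ω) ∘L (h1Submodule Ω).subtypeL ∘L (vSubmodule Ω Γu).subtypeL

/-- The form `(u, v) ↦ ∫_Ω c u v` as a map from `𝒱` to its dual; `c ∂u/∂t` is the derivative of
the function `t ↦ massForm Γu hc (u t)`. -/
def massForm (Γu : Set (E d)) (hc : MemLp c ∞ (volume.restrict Ω)) :
    V Ω Γu →L[ℝ] StrongDual ℝ (V Ω Γu) :=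
  (innerSL ℝ ∘L weightL ℝ hc).bilinearComp (V.fnL Ω Γu) (V.fnL Ω Γu)

theorem inner_weightL_eq_integral (hc : MemLp c ∞ (volume.restrict Ω)) (u v : L2 Ω) :
    ⟪weightL ℝ hc u, v⟫ = ∫ x in Ω, c x * u x * v x := by
  rw [L2.inner_def]
  refine integral_congr_ae ?_
  filter_upwards [coeFn_weightL hc u] with x hx
  rw [hx, smul_eq_mul, RCLike.inner_apply, conj_trivial, mul_comm]

theorem massForm_apply (hc : MemLp c ∞ (volume.restrict Ω)) (u v : V Ω Γu) :
    massForm Γu hc u v = ∫ x in Ω, c x * u.fn x * v.fn x :=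
  inner_weightL_eq_integral hc u.fn v.fn

theorem massForm_comm (hc : MemLp c ∞ (volume.restrict Ω)) (u v : V Ω Γu) :
    massForm Γu hc u v = massForm Γu hc v u := by
  simp only [massForm_apply, mul_assoc, mul_comm (u.fn _)]

theorem massForm_self_nonneg (hc : MemLp c ∞ (volume.restrict Ω))
    (hc0 : ∀ᵐ x ∂(volume.restrict Ω), 0 ≤ c x) (u : V Ω Γu) : 0 ≤ massForm Γu hc u u := by
  rw [massForm_apply]
  refine integral_nonneg_of_ae ?_
  filter_upwards [hc0] with x hx
  simp only [Pi.zero_apply, mul_assoc]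
  exact mul_nonneg hx (mul_self_nonneg _)

namespace Evolution

theorem inner_weightL_sub_eq_integral (hT : 0 < T) (hc : MemLp c ∞ (volume.restrict Ω))
    (u : Evolution Ω Γu T c) {w : ℝ → L2 Ω} (hw : ContinuousOn w (Icc 0 T))
    (hwu : ∀ᵐ t ∂(timeMeasure T), w t = (u.toFun t).fn) (v : V Ω Γu) {s t : ℝ}
    (hs : s ∈ Icc 0 T) (ht : t ∈ Icc 0 T) :
    ⟪weightL ℝ hc (w t), v.fn⟫ - ⟪weightL ℝ hc (w s), v.fn⟫ = ∫ x in s..t, u.cdt x v := by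
  refine HasWeakDeriv.sub_eq_integral (F := fun t => ⟪weightL ℝ hc (w t), v.fn⟫) hT
    (((weightL ℝ hc).continuous.comp_continuousOn hw).inner continuousOn_const)
    ((ContinuousLinearMap.apply ℝ ℝ v).integrable_comp
      ((Lp.memLp u.cdt).integrable one_le_two)) (fun φ hφ => ?_) hs ht
  refine Eq.trans (integral_congr_ae ?_)
    (u.weak_deriv v φ hφ.contDiff hφ.hasCompactSupport hφ.tsupport_subset)
  filter_upwards [hwu] with x hx
  rw [hx, inner_weightL_eq_integral]

theorem massForm_eq_integral (hT : 0 < T) (hc : MemLp c ∞ (volume.restrict Ω))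
    {u : Evolution Ω Γu T c} {t₀ : ℝ} (ht₀ : t₀ ∈ Icc 0 T) (hu : u.VanishesAt t₀) :
    ∀ᵐ t ∂(timeMeasure T),
      massForm Γu hc (u.toFun t) = ∫ s in t₀..t, (Icc 0 T).indicator u.cdt s := by
  obtain ⟨w, hw, hwu, hw₀⟩ := hu
  have hcdt : IntegrableOn u.cdt (Icc 0 T) := (Lp.memLp u.cdt).integrable one_le_two
  filter_upwards [hwu, ae_restrict_mem measurableSet_Icc] with t hwt ht
  have hsub : uIcc t₀ t ⊆ Icc 0 T := uIcc_subset_Icc ht₀ ht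
  have hcdt_t : IntervalIntegrable u.cdt volume t₀ t :=
    (hcdt.mono_set hsub).intervalIntegrable
  rw [intervalIntegral.integral_congr fun s hs => indicator_of_mem (hsub hs) u.cdt]
  ext v
  rw [ContinuousLinearMap.intervalIntegral_apply hcdt_t,
    ← u.inner_weightL_sub_eq_integral hT hc hw hwu v ht₀ ht, hw₀, map_zero, inner_zero_left,
    sub_zero, hwt]
  rfl

theorem isPrimitiveOn_indicator (hT : 0 < T) (hc : MemLp c ∞ (volume.restrict Ω))
    {u : Evolution Ω Γu T c} {t₀ : ℝ} (ht₀ : t₀ ∈ Icc 0 T) (hu : u.VanishesAt t₀) {J : Set ℝ}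
    (hJ : ∀ t ∈ J, t ∉ Icc 0 T → Disjoint (uIoo t₀ t) (Icc 0 T)) :
    IsPrimitiveOn (massForm Γu hc) J t₀ ((Icc 0 T).indicator u.toFun)
      ((Icc 0 T).indicator u.cdt) where
  memLp := (memLp_indicator_iff_restrict measurableSet_Icc).2 (Lp.memLp u.toFun)
  memLp_deriv := (memLp_indicator_iff_restrict measurableSet_Icc).2 (Lp.memLp u.cdt)
  eq_integral := by
    filter_upwards [(ae_restrict_iff' measurableSet_Icc).1 (massForm_eq_integral hT hc ht₀ hu)]
      with t ht htJ
    by_cases htI : t ∈ Icc 0 T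
    · rw [indicator_of_mem htI, ht htI]
    · have hzero : (uIoo t₀ t).EqOn ((Icc 0 T).indicator u.cdt) 0 := fun s hs =>
        indicator_of_notMem ((hJ t htJ htI).notMem_of_mem_left hs) u.cdt
      rw [indicator_of_notMem htI, map_zero, intervalIntegral.integral_congr_uIoo hzero]
      exact intervalIntegral.integral_zero.symm

theorem isPrimitiveOn_Iic (hT : 0 < T) (hc : MemLp c ∞ (volume.restrict Ω))
    {u : Evolution Ω Γu T c} (hu : u.VanishesAt 0) :
    IsPrimitiveOn (massForm Γu hc) (Iic T) 0 ((Icc 0 T).indicator u.toFun)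
      ((Icc 0 T).indicator u.cdt) := by
  refine isPrimitiveOn_indicator hT hc (left_mem_Icc.2 hT.le) hu fun t htT ht => ?_
  have ht0 : t < 0 := not_le.1 fun h => ht ⟨h, htT⟩
  rw [uIoo_of_ge ht0.le]
  exact disjoint_left.2 fun s hs hs' => hs.2.not_ge hs'.1

theorem isPrimitiveOn_Ici (hT : 0 < T) (hc : MemLp c ∞ (volume.restrict Ω))
    {u : Evolution Ω Γu T c} (hu : u.VanishesAt T) :
    IsPrimitiveOn (massForm Γu hc) (Ici 0) T ((Icc 0 T).indicator u.toFun)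
      ((Icc 0 T).indicator u.cdt) := by
  refine isPrimitiveOn_indicator hT hc (right_mem_Icc.2 hT.le) hu fun t ht0 ht => ?_
  have htT : T < t := not_le.1 fun h => ht ⟨ht0, h⟩
  rw [uIoo_of_le htT.le]
  exact disjoint_left.2 fun s hs hs' => hs.1.not_ge hs'.2

/-- The space-time pairing `v ↦ ∫_I ∫_Ω c ∂u/∂t v` as a bounded functional on `L²(I; 𝒱)`. -/
def cdtPairing (u : Evolution Ω Γu T c) : L2Time T (V Ω Γu) →L[ℝ] ℝ :=
  (ContinuousLinearMap.id ℝ (StrongDual ℝ (V Ω Γu))).lpPairing (timeMeasure T) 2 2 u.cdt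

theorem cdtPairing_apply (u : Evolution Ω Γu T c) (v : L2Time T (V Ω Γu)) :
    u.cdtPairing v = ∫ t, u.cdt t (v t) ∂(timeMeasure T) :=
  ContinuousLinearMap.lpPairing_eq_integral _ u.cdt v

theorem integrable_cdt (u : Evolution Ω Γu T c) (v : L2Time T (V Ω Γu)) :
    Integrable (fun t => u.cdt t (v t)) (timeMeasure T) :=
  integrable_bilin (ContinuousLinearMap.id ℝ _) (Lp.memLp u.cdt) (Lp.memLp v)

theorem cdtPairing_add_cdtPairing_eq_zero (hT : 0 < T) (hc : MemLp c ∞ (volume.restrict Ω))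
    {u v : Evolution Ω Γu T c} (hu : u.VanishesAt 0) (hv : v.VanishesAt T) :
    u.cdtPairing v.toFun + v.cdtPairing u.toFun = 0 := by
  rw [cdtPairing_apply, cdtPairing_apply, ← integral_indicator_apply, ← integral_indicator_apply]
  exact IsPrimitiveOn.integral_add_integral_eq_zero (massForm_comm hc)
    (isPrimitiveOn_Iic hT hc hu) (isPrimitiveOn_Ici hT hc hv) support_indicator_subset
    support_indicator_subset

theorem cdtPairing_sub_le (hT : 0 < T) (hc : MemLp c ∞ (volume.restrict Ω))
    (hc0 : ∀ᵐ x ∂(volume.restrict Ω), 0 ≤ c x) {u v : Evolution Ω Γu T c} (hu : u.VanishesAt 0)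
    (hv : v.VanishesAt 0) :
    v.cdtPairing (u.toFun - v.toFun) ≤ u.cdtPairing (u.toFun - v.toFun) := by
  have hnonneg : 0 ≤ ∫ t, (u.cdt t - v.cdt t) (u.toFun t - v.toFun t) ∂(timeMeasure T) := by
    have hsub := (isPrimitiveOn_Iic hT hc hu).sub (isPrimitiveOn_Iic hT hc hv)
    rw [← indicator_sub', ← indicator_sub'] at hsub
    rw [← integral_indicator_apply]
    exact hsub.integral_nonneg (massForm_comm hc) (massForm_self_nonneg hc hc0)
      (support_indicator_subset.trans Icc_subset_Iic_self)
  rw [← sub_nonneg, cdtPairing_apply, cdtPairing_apply,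
    ← integral_sub (u.integrable_cdt _) (v.integrable_cdt _)]
  refine hnonneg.trans_eq (integral_congr_ae ?_)
  filter_upwards [Lp.coeFn_sub u.toFun v.toFun] with t ht
  rw [ht, Pi.sub_apply, sub_apply]

end Evolution

end TimeDerivative

section ScaledFluxes

variable {d : ℕ} {Ω Γu : Set (E d)} {T : ℝ} {c k r : E d → ℝ}

namespace AdmissibleCoefficients

theorem memLp_c (h : AdmissibleCoefficients Ω c k r) : MemLp c ∞ (volume.restrict Ω) := by
  obtain ⟨c₀, c₁, hc₀, hc⟩ := h.c_bound
  refine memLp_top_of_bound h.c_meas.aestronglyMeasurable c₁ ?_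
  filter_upwards [hc] with x hx
  rw [Real.norm_of_nonneg (hc₀.le.trans hx.1)]
  exact hx.2

theorem memLp_k (h : AdmissibleCoefficients Ω c k r) : MemLp k ∞ (volume.restrict Ω) := by
  obtain ⟨k₀, k₁, hk₀, hk⟩ := h.k_bound
  refine memLp_top_of_bound h.k_meas.aestronglyMeasurable k₁ ?_
  filter_upwards [hk] with x hx
  rw [Real.norm_of_nonneg (hk₀.le.trans hx.1)]
  exact hx.2

theorem memLp_r (h : AdmissibleCoefficients Ω c k r) : MemLp r ∞ (volume.restrict Ω) := by
  obtain ⟨r₁, hr⟩ := h.r_bound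
  refine memLp_top_of_bound h.r_meas.aestronglyMeasurable r₁ ?_
  filter_upwards [hr] with x hx
  rw [Real.norm_of_nonneg hx.1]
  exact hx.2

theorem c_nonneg (h : AdmissibleCoefficients Ω c k r) : ∀ᵐ x ∂(volume.restrict Ω), 0 ≤ c x := by
  obtain ⟨c₀, c₁, hc₀, hc⟩ := h.c_bound
  filter_upwards [hc] with x hx using hc₀.le.trans hx.1

theorem k_nonneg (h : AdmissibleCoefficients Ω c k r) : ∀ᵐ x ∂(volume.restrict Ω), 0 ≤ k x := by
  obtain ⟨k₀, k₁, hk₀, hk⟩ := h.k_bound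
  filter_upwards [hk] with x hx using hk₀.le.trans hx.1

theorem r_nonneg (h : AdmissibleCoefficients Ω c k r) : ∀ᵐ x ∂(volume.restrict Ω), 0 ≤ r x := by
  obtain ⟨r₁, hr⟩ := h.r_bound
  filter_upwards [hr] with x hx using hx.1

end AdmissibleCoefficients

/-- The continuous linear map `v ↦ ∇v` from `𝒱` to `L²(Ω)^d`. -/
def V.gradL (Ω Γu : Set (E d)) : V Ω Γu →L[ℝ] L2Vec Ω :=
  WithLp.sndL 2 ℝ (L2 Ω) (L2Vec Ω) ∘L (h1Submodule Ω).subtypeL ∘L (vSubmodule Ω Γu).subtypeL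

/-- The Hilbert space of the pairs of a vector field and a scalar field on `I × Ω`, in which the
energy products of the problem become inner products. -/
abbrev FluxSpace (Ω : Set (E d)) (T : ℝ) : Type :=
  WithLp 2 (L2Time T (L2Vec Ω) × L2Time T (L2 Ω))

theorem integral_ae_eq_inner_add_inner (A B : FluxSpace Ω T) {φ : ℝ → E d → ℝ}
    (hφ : ∀ᵐ t ∂(timeMeasure T), ∀ᵐ x ∂(volume.restrict Ω),
      φ t x = ⟪A.fst t x, B.fst t x⟫ + A.snd t x * B.snd t x) :
    (fun t => ∫ x in Ω, φ t x) =ᵐ[timeMeasure T]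
      fun t => ⟪A.fst t, B.fst t⟫ + ⟪A.snd t, B.snd t⟫ := by
  filter_upwards [hφ] with t ht
  rw [L2.inner_def, L2.inner_def, ← integral_add (L2.integrable_inner _ _)
    (L2.integrable_inner _ _)]
  refine integral_congr_ae ?_
  filter_upwards [ht] with x hx
  rw [hx, RCLike.inner_apply, conj_trivial, mul_comm (B.snd t x)]

theorem integrable_of_ae_eq_inner (A B : FluxSpace Ω T) {φ : ℝ → E d → ℝ}
    (hφ : ∀ᵐ t ∂(timeMeasure T), ∀ᵐ x ∂(volume.restrict Ω),
      φ t x = ⟪A.fst t x, B.fst t x⟫ + A.snd t x * B.snd t x) :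
    Integrable (fun t => ∫ x in Ω, φ t x) (timeMeasure T) :=
  ((L2.integrable_inner A.fst B.fst).add (L2.integrable_inner A.snd B.snd)).congr
    (integral_ae_eq_inner_add_inner A B hφ).symm

theorem integral_integral_eq_inner (A B : FluxSpace Ω T) {φ : ℝ → E d → ℝ}
    (hφ : ∀ᵐ t ∂(timeMeasure T), ∀ᵐ x ∂(volume.restrict Ω),
      φ t x = ⟪A.fst t x, B.fst t x⟫ + A.snd t x * B.snd t x) :
    ∫ t, (∫ x in Ω, φ t x) ∂(timeMeasure T) = ⟪A, B⟫ := by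
  rw [integral_congr_ae (integral_ae_eq_inner_add_inner A B hφ), integral_add
    (L2.integrable_inner A.fst B.fst) (L2.integrable_inner A.snd B.snd), ← L2.inner_def,
    ← L2.inner_def]
  rfl

/-- The pair `(q, z)` is `(√k B₁, √r B₂)`. -/
def IsSqrtScaled (k r : E d → ℝ) (q : ℝ → E d → E d) (z : ℝ → E d → ℝ) (B : FluxSpace Ω T) :
    Prop :=
  ∀ᵐ t ∂(timeMeasure T), ∀ᵐ x ∂(volume.restrict Ω),
    q t x = √(k x) • B.fst t x ∧ z t x = √(r x) * B.snd t x

/-- The pair `(q, z)` is `(√k A₁, √r A₂)`, with the value `0` of `A₁` and `A₂` where `k` and `r`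
vanish; then `1/k |q|² + 1/r z² = |A|²` with the convention that quotients by `0` are `0`. -/
structure IsScaledGap (k r : E d → ℝ) (q : ℝ → E d → E d) (z : ℝ → E d → ℝ)
    (A : FluxSpace Ω T) : Prop where
  diffusion : ∀ᵐ t ∂(timeMeasure T), IsSqrtQuotient (volume.restrict Ω) k (q t) (A.fst t)
  reaction : ∀ᵐ t ∂(timeMeasure T), IsSqrtQuotient (volume.restrict Ω) r (z t) (A.snd t)

variable {q q' : ℝ → E d → E d} {z z' : ℝ → E d → ℝ} {A B : FluxSpace Ω T}

theorem IsScaledGap.isSqrtScaled (h : IsScaledGap k r q z A) : IsSqrtScaled k r q z A := by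
  filter_upwards [h.diffusion, h.reaction] with t hqt hzt
  filter_upwards [hqt, hzt] with x hqx hzx using ⟨hqx.1, hzx.1⟩

theorem IsSqrtScaled.add (hA : IsSqrtScaled k r q z A) (hB : IsSqrtScaled k r q' z' B) :
    IsSqrtScaled k r (q + q') (z + z') (A + B) := by
  filter_upwards [hA, hB, coeFn_coeFn_add A.fst B.fst, coeFn_coeFn_add A.snd B.snd]
    with t hAt hBt hfst hsnd
  filter_upwards [hAt, hBt, hfst, hsnd] with x hAx hBx hfst hsnd
  simp only [WithLp.add_fst, WithLp.add_snd, hfst, hsnd, Pi.add_apply, hAx, hBx, smul_add, mul_add,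
    and_self]

theorem IsSqrtScaled.const_smul (s : ℝ) (hA : IsSqrtScaled k r q z A) :
    IsSqrtScaled k r (s • q) (s • z) (s • A) := by
  filter_upwards [hA, coeFn_coeFn_smul s A.fst, coeFn_coeFn_smul s A.snd] with t hAt hfst hsnd
  filter_upwards [hAt, hfst, hsnd] with x hAx hfst hsnd
  simp only [WithLp.smul_fst, WithLp.smul_snd, hfst, hsnd, Pi.smul_apply, hAx, smul_comm s,
    smul_eq_mul, mul_left_comm s, and_self]

theorem IsScaledGap.integral_eq_inner (hk : ∀ᵐ x ∂(volume.restrict Ω), 0 ≤ k x)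
    (hr : ∀ᵐ x ∂(volume.restrict Ω), 0 ≤ r x) (hA : IsScaledGap k r q z A)
    (hB : IsSqrtScaled k r q' z' B) :
    ∫ t, (∫ x in Ω, (1 / k x * ⟪q t x, q' t x⟫ + 1 / r x * z t x * z' t x)) ∂(timeMeasure T)
      = ⟪A, B⟫ := by
  refine integral_integral_eq_inner A B ?_
  filter_upwards [hA.diffusion, hA.reaction, hB] with t hqt hzt hBt
  filter_upwards [hqt, hzt, hBt, hk, hr] with x hqx hzx hBx hkx hrx
  have hreaction := inv_mul_inner_sqrt_smul hrx hzx.2 (B.snd t x)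
  simp only [RCLike.inner_apply, conj_trivial, smul_eq_mul] at hreaction
  rw [hqx.1, hzx.1, hBx.1, hBx.2, inv_mul_inner_sqrt_smul hkx hqx.2,
    mul_comm (A.snd t x), ← hreaction]
  ring

namespace AdmissibleCoefficients

/-- The map `v ↦ (√k ∇v, √r v)`, whose norm is the energy norm. -/
def energyMap (h : AdmissibleCoefficients Ω c k r) (Γu : Set (E d)) (T : ℝ) :
    L2Time T (V Ω Γu) →L[ℝ] FluxSpace Ω T :=
  (WithLp.prodContinuousLinearEquiv 2 ℝ _ _).symm.toContinuousLinearMap ∘L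
    ((weightL (E d) (memLp_top_sqrt h.memLp_k) ∘L V.gradL Ω Γu).compLpL 2 (timeMeasure T)).prod
      ((weightL ℝ (memLp_top_sqrt h.memLp_r) ∘L V.fnL Ω Γu).compLpL 2 (timeMeasure T))

theorem coeFn_energyMap (h : AdmissibleCoefficients Ω c k r) (v : L2Time T (V Ω Γu)) :
    ∀ᵐ t ∂(timeMeasure T), ∀ᵐ x ∂(volume.restrict Ω),
      (h.energyMap Γu T v).fst t x = √(k x) • (v t).grad x ∧
        (h.energyMap Γu T v).snd t x = √(r x) * (v t).fn x := by
  filter_upwards [coeFn_compLp_weightL (memLp_top_sqrt h.memLp_k) (V.gradL Ω Γu) v,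
    coeFn_compLp_weightL (memLp_top_sqrt h.memLp_r) (V.fnL Ω Γu) v] with t hgrad hfn
  filter_upwards [hgrad, hfn] with x hgrad hfn using ⟨hgrad, hfn⟩

theorem isSqrtScaled_energyMap (h : AdmissibleCoefficients Ω c k r) (v : L2Time T (V Ω Γu)) :
    IsSqrtScaled k r (fun t x => k x • (v t).grad x) (fun t x => r x * (v t).fn x)
      (h.energyMap Γu T v) := by
  filter_upwards [h.coeFn_energyMap v] with t ht
  filter_upwards [ht, h.k_nonneg, h.r_nonneg] with x hx hkx hrx
  rw [hx.1, hx.2, smul_smul, ← mul_assoc, Real.mul_self_sqrt hkx, Real.mul_self_sqrt hrx]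
  exact ⟨rfl, rfl⟩

theorem inner_grad_add_mul_fn_eq (h : AdmissibleCoefficients Ω c k r)
    (hB : IsSqrtScaled k r q z B) (v : L2Time T (V Ω Γu)) :
    ∀ᵐ t ∂(timeMeasure T), ∀ᵐ x ∂(volume.restrict Ω),
      ⟪q t x, (v t).grad x⟫ + z t x * (v t).fn x
        = ⟪B.fst t x, (h.energyMap Γu T v).fst t x⟫
          + B.snd t x * (h.energyMap Γu T v).snd t x := by
  filter_upwards [hB, h.coeFn_energyMap v] with t hBt hvt
  filter_upwards [hBt, hvt] with x hBx hvx
  rw [hBx.1, hBx.2, hvx.1, hvx.2, real_inner_smul_left, real_inner_smul_right]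
  ring

theorem integral_cdt_add_integral_eq (h : AdmissibleCoefficients Ω c k r)
    (hB : IsSqrtScaled k r q z B) (u : Evolution Ω Γu T c) (v : L2Time T (V Ω Γu)) :
    ∫ t, (u.cdt t (v t) + ∫ x in Ω, (⟪q t x, (v t).grad x⟫ + z t x * (v t).fn x))
      ∂(timeMeasure T) = u.cdtPairing v + ⟪B, h.energyMap Γu T v⟫ := by
  have hpair := h.inner_grad_add_mul_fn_eq hB v
  rw [integral_add (u.integrable_cdt v) (integrable_of_ae_eq_inner _ _ hpair),
    integral_integral_eq_inner _ _ hpair, u.cdtPairing_apply]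

theorem integral_neg_cdt_add_integral_eq (h : AdmissibleCoefficients Ω c k r)
    (hB : IsSqrtScaled k r q z B) (u : Evolution Ω Γu T c) (v : L2Time T (V Ω Γu)) :
    ∫ t, (-u.cdt t (v t) + ∫ x in Ω, (⟪q t x, (v t).grad x⟫ + z t x * (v t).fn x))
      ∂(timeMeasure T) = -u.cdtPairing v + ⟪B, h.energyMap Γu T v⟫ := by
  have hpair := h.inner_grad_add_mul_fn_eq hB v
  rw [integral_add (u.integrable_cdt v).fun_neg (integrable_of_ae_eq_inner _ _ hpair),
    integral_neg, integral_integral_eq_inner _ _ hpair, u.cdtPairing_apply]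

theorem b_eq (h : AdmissibleCoefficients Ω c k r) (u : Evolution Ω Γu T c)
    (v : L2Time T (V Ω Γu)) :
    b k r u v = u.cdtPairing v + ⟪h.energyMap Γu T u.toFun, h.energyMap Γu T v⟫ := by
  rw [← h.integral_cdt_add_integral_eq (h.isSqrtScaled_energyMap u.toFun) u v]
  simp only [b, real_inner_smul_left]

end AdmissibleCoefficients

end ScaledFluxes

section ConstitutiveGap

variable {d : ℕ} {Ω Γu Γq : Set (E d)} {T : ℝ} {c k r : E d → ℝ} {f : L2Time T (L2 Ω)}
  {g : L2Time T (Lp ℝ 2 ((surfaceMeasure Ω).restrict Γq))} {qS : L2Time T (L2Vec Ω)}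
  {fS : L2Time T (L2 Ω)} {u um ua : Evolution Ω Γu T c} {q qm qa : L2Time T (L2Vec Ω)}
  {z zm za : L2Time T (L2 Ω)} {A A' : FluxSpace Ω T}

/-- `A` is the scaled constitutive gap `((q - k∇u)/√k, (z - ru)/√r)` of the triplet `(u, q, z)`,
whose norm is the constitutive relation error. -/
abbrev IsConstitutiveGap (k r : E d → ℝ) (u : Evolution Ω Γu T c) (q : L2Time T (L2Vec Ω))
    (z : L2Time T (L2 Ω)) (A : FluxSpace Ω T) : Prop :=
  IsScaledGap k r (fun t x => q t x - k x • (u.toFun t).grad x)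
    (fun t x => z t x - r x * (u.toFun t).fn x) A

namespace AdmissibleCoefficients

theorem exists_isConstitutiveGap (h : AdmissibleCoefficients Ω c k r)
    (q : L2Time T (L2Vec Ω)) (hfin : HasFiniteCRE r u z) :
    ∃ A : FluxSpace Ω T, IsConstitutiveGap k r u q z A := by
  let gapQ : L2Time T (L2Vec Ω) := q - (weightL (E d) h.memLp_k ∘L V.gradL Ω Γu).compLp u.toFun
  let gapZ : L2Time T (L2 Ω) := z - (weightL ℝ h.memLp_r ∘L V.fnL Ω Γu).compLp u.toFun
  have hgapQ : ∀ᵐ t ∂(timeMeasure T), gapQ t =ᵐ[volume.restrict Ω]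
      fun x => q t x - k x • (u.toFun t).grad x :=
    coeFn_sub_compLp_weightL h.memLp_k (V.gradL Ω Γu) q u.toFun
  have hgapZ : ∀ᵐ t ∂(timeMeasure T), gapZ t =ᵐ[volume.restrict Ω]
      fun x => z t x - r x * (u.toFun t).fn x :=
    coeFn_sub_compLp_weightL h.memLp_r (V.fnL Ω Γu) z u.toFun
  have hsq : ∀ᵐ t ∂(timeMeasure T), (fun x => 1 / r x * (z t x - r x * (u.toFun t).fn x) ^ 2)
      =ᵐ[volume.restrict Ω] fun x => 1 / r x * ‖gapZ t x‖ ^ 2 := by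
    filter_upwards [hgapZ] with t ht
    filter_upwards [ht] with x hx
    rw [hx, Real.norm_eq_abs, sq_abs]
  obtain ⟨k₀, k₁, hk₀, hk⟩ := h.k_bound
  obtain ⟨A₁, hA₁⟩ := exists_isSqrtQuotient_of_bounded_below h.k_meas hk₀
    (hk.mono fun x hx => hx.1) gapQ
  obtain ⟨A₂, hA₂⟩ := exists_isSqrtQuotient_of_integrable h.r_meas h.r_nonneg gapZ
    (by
      filter_upwards [hgapZ, hfin.zero_of_zero] with t ht hzt
      filter_upwards [ht, hzt] with x hx hzx h0
      rw [hx, hzx h0, h0, zero_mul, sub_zero])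
    (by filter_upwards [hfin.integrable_space, hsq] with t ht hsqt using ht.congr hsqt)
    (hfin.integrable_time.congr (by filter_upwards [hsq] with t ht using integral_congr_ae ht))
  refine ⟨WithLp.toLp 2 (A₁, A₂), ?_, ?_⟩
  · filter_upwards [hA₁, hgapQ] with t ht hqt
    filter_upwards [ht, hqt] with x hx hqx using hqx ▸ hx
  · filter_upwards [hA₂, hgapZ] with t ht hzt
    filter_upwards [ht, hzt] with x hx hzx using hzx ▸ hx

theorem isSqrtScaled_flux (h : AdmissibleCoefficients Ω c k r)
    (hA : IsConstitutiveGap k r u q z A) :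
    IsSqrtScaled k r (fun t => q t) (fun t => z t) (A + h.energyMap Γu T u.toFun) := by
  convert hA.isSqrtScaled.add (h.isSqrtScaled_energyMap u.toFun) using 1 <;> ext <;> simp

theorem isSqrtScaled_average (h : AdmissibleCoefficients Ω c k r)
    (hA : IsConstitutiveGap k r u q z A) :
    IsSqrtScaled k r (fun t x => (1 / 2 : ℝ) • (q t x + k x • (u.toFun t).grad x))
      (fun t x => 1 / 2 * (z t x + r x * (u.toFun t).fn x))
      ((1 / 2 : ℝ) • A + h.energyMap Γu T u.toFun) := by
  have hmean : (1 / 2 : ℝ) • A + h.energyMap Γu T u.toFun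
      = (1 / 2 : ℝ) • (A + h.energyMap Γu T u.toFun + h.energyMap Γu T u.toFun) := by module
  rw [hmean]
  exact ((h.isSqrtScaled_flux hA).add (h.isSqrtScaled_energyMap u.toFun)).const_smul (1 / 2)

theorem isSqrtScaled_average_sub (hA : IsConstitutiveGap k r u q z A) :
    IsSqrtScaled k r
      (fun t x => (1 / 2 : ℝ) • (q t x + k x • (u.toFun t).grad x) - k x • (u.toFun t).grad x)
      (fun t x => 1 / 2 * (z t x + r x * (u.toFun t).fn x) - r x * (u.toFun t).fn x)
      ((1 / 2 : ℝ) • A) := by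
  convert hA.isSqrtScaled.const_smul (1 / 2) using 1
  · ext1 t
    ext1 x
    simp only [Pi.smul_apply]
    module
  · ext t x
    simp only [Pi.smul_apply, smul_eq_mul]
    ring

theorem cre_eq_norm (h : AdmissibleCoefficients Ω c k r) (hA : IsConstitutiveGap k r u q z A) :
    cre k r u q z = ‖A‖ := by
  rw [cre, norm_eq_sqrt_real_inner,
    ← hA.integral_eq_inner h.k_nonneg h.r_nonneg hA.isSqrtScaled]
  simp only [creSpaceSq, real_inner_self_eq_norm_sq, sq (_ - _), mul_assoc]

theorem Qcorr_eq_inner (h : AdmissibleCoefficients Ω c k r)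
    (hA : IsConstitutiveGap k r um qm zm A) (hA' : IsConstitutiveGap k r ua qa za A') :
    Qcorr k r um qm zm ua qa za = ⟪A, (1 / 2 : ℝ) • A' + h.energyMap Γu T ua.toFun⟫ :=
  hA.integral_eq_inner h.k_nonneg h.r_nonneg (h.isSqrtScaled_average hA')

theorem corrShift_eq_inner (h : AdmissibleCoefficients Ω c k r)
    (hA : IsConstitutiveGap k r um qm zm A) (hA' : IsConstitutiveGap k r ua qa za A') :
    corrShift k r um qm zm ua qa za = ⟪A', (1 / 2 : ℝ) • A⟫ :=
  hA'.integral_eq_inner h.k_nonneg h.r_nonneg (isSqrtScaled_average_sub hA)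

theorem l_eq (h : AdmissibleCoefficients Ω c k r) (hm : IsPrimalAdmissible f g um qm zm)
    (hA : IsConstitutiveGap k r um qm zm A) (v : L2Time T (V Ω Γu)) :
    l f g v = um.cdtPairing v
      + ⟪A + h.energyMap Γu T um.toFun, h.energyMap Γu T v⟫ := by
  rw [← h.integral_cdt_add_integral_eq (h.isSqrtScaled_flux hA) um v, l]
  refine integral_congr_ae ?_
  filter_upwards [hm.equilibrium] with t ht using (ht (v t)).symm

theorem Q_eq (h : AdmissibleCoefficients Ω c k r) (ha : IsAdjointAdmissible qS fS ua qa za)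
    (hA' : IsConstitutiveGap k r ua qa za A') (v : L2Time T (V Ω Γu)) :
    Q qS fS v = -ua.cdtPairing v
      + ⟪A' + h.energyMap Γu T ua.toFun, h.energyMap Γu T v⟫ := by
  rw [← h.integral_neg_cdt_add_integral_eq (h.isSqrtScaled_flux hA') ua v, Q]
  refine integral_congr_ae ?_
  filter_upwards [ha.equilibrium] with t ht using (ht (v t)).symm

theorem R_eq_inner (h : AdmissibleCoefficients Ω c k r) (hm : IsPrimalAdmissible f g um qm zm)
    (hA : IsConstitutiveGap k r um qm zm A) (v : L2Time T (V Ω Γu)) :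
    R k r f g um v = ⟪A, h.energyMap Γu T v⟫ := by
  rw [R, h.l_eq hm hA, h.b_eq, inner_add_left]
  ring

theorem Qcorr_eq_R_add_corrShift (h : AdmissibleCoefficients Ω c k r)
    (hm : IsPrimalAdmissible f g um qm zm) (hA : IsConstitutiveGap k r um qm zm A)
    (hA' : IsConstitutiveGap k r ua qa za A') :
    Qcorr k r um qm zm ua qa za
      = R k r f g um ua.toFun + corrShift k r um qm zm ua qa za := by
  rw [h.Qcorr_eq_inner hA hA', h.R_eq_inner hm hA, h.corrShift_eq_inner hA hA', inner_add_right,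
    real_inner_smul_right, real_inner_smul_right, real_inner_comm, add_comm]

theorem norm_sq_energyMap_sub_le (h : AdmissibleCoefficients Ω c k r) (hT : 0 < T)
    (hu : IsWeakSolution k r f g u) (hm : IsPrimalAdmissible f g um qm zm)
    (hA : IsConstitutiveGap k r um qm zm A) :
    ‖h.energyMap Γu T (u.toFun - um.toFun)‖ ^ 2
      ≤ ⟪A, h.energyMap Γu T (u.toFun - um.toFun)⟫ := by
  have hpos := Evolution.cdtPairing_sub_le hT h.memLp_c h.c_nonneg hu.1 hm.initial
  have hweak := hu.2 (u.toFun - um.toFun)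
  rw [h.b_eq, h.l_eq hm hA, inner_add_left] at hweak
  rw [← real_inner_self_eq_norm_sq]
  nth_rewrite 1 [map_sub]
  rw [inner_sub_left]
  linarith

theorem Q_sub_Q_sub_R_eq_inner (h : AdmissibleCoefficients Ω c k r) (hT : 0 < T)
    (hu : IsWeakSolution k r f g u) (hm : IsPrimalAdmissible f g um qm zm)
    (hA : IsConstitutiveGap k r um qm zm A) (ha : IsAdjointAdmissible qS fS ua qa za)
    (hA' : IsConstitutiveGap k r ua qa za A') :
    Q qS fS u.toFun - Q qS fS um.toFun - R k r f g um ua.toFun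
      = ⟪A', h.energyMap Γu T (u.toFun - um.toFun)⟫ := by
  have hparts := Evolution.cdtPairing_add_cdtPairing_eq_zero hT h.memLp_c hu.1 ha.final
  have hparts_m := Evolution.cdtPairing_add_cdtPairing_eq_zero hT h.memLp_c hm.initial ha.final
  have hweak := hu.2 ua.toFun
  rw [h.b_eq, h.l_eq hm hA, inner_add_left, real_inner_comm,
    real_inner_comm (h.energyMap Γu T ua.toFun) (h.energyMap Γu T um.toFun)] at hweak
  rw [h.Q_eq ha hA', h.Q_eq ha hA', h.R_eq_inner hm hA, map_sub, inner_sub_right, inner_add_left,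
    inner_add_left]
  linarith

end AdmissibleCoefficients

end ConstitutiveGap

section InnerProductSpace

variable {H : Type*} [NormedAddCommGroup H] [InnerProductSpace ℝ H] {x y : H}

theorem norm_sub_half_smul_le_of_norm_sq_le_inner (h : ‖y‖ ^ 2 ≤ ⟪x, y⟫) :
    ‖y - (1 / 2 : ℝ) • x‖ ≤ 1 / 2 * ‖x‖ := by
  refine le_of_sq_le_sq ?_ (by positivity)
  rw [norm_sub_sq_real, real_inner_smul_right, norm_smul, Real.norm_of_nonneg one_half_pos.le,
    real_inner_comm]
  linarith

theorem norm_le_of_norm_sq_le_inner (h : ‖y‖ ^ 2 ≤ ⟪x, y⟫) : ‖y‖ ≤ ‖x‖ := by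
  have hhalf := norm_sub_half_smul_le_of_norm_sq_le_inner h
  have htriangle := norm_le_norm_sub_add y ((1 / 2 : ℝ) • x)
  rw [norm_smul, Real.norm_of_nonneg one_half_pos.le] at htriangle
  linarith

end InnerProductSpace

end ParabolicCRE

end

theorem mainTheorem2_general {d : ℕ} {Ω Γu Γq : Set (E d)} {T : ℝ} (hT : 0 < T)
    {c k r : E d → ℝ} (hcoef : AdmissibleCoefficients Ω c k r) {f : L2Time T (L2 Ω)}
    {g : L2Time T (Lp ℝ 2 ((surfaceMeasure Ω).restrict Γq))} {qS : L2Time T (L2Vec Ω)}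
    {fS : L2Time T (L2 Ω)} {u : Evolution Ω Γu T c} (hu : IsWeakSolution k r f g u)
    {um : Evolution Ω Γu T c} {qm : L2Time T (L2Vec Ω)} {zm : L2Time T (L2 Ω)}
    (hm : IsPrimalAdmissible f g um qm zm) (hm_fin : HasFiniteCRE r um zm)
    {ua : Evolution Ω Γu T c} {qa : L2Time T (L2Vec Ω)} {za : L2Time T (L2 Ω)}
    (ha : IsAdjointAdmissible qS fS ua qa za) (ha_fin : HasFiniteCRE r ua za) :
    |Q qS fS u.toFun - Q qS fS um.toFun - R k r f g um ua.toFun|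
        ≤ cre k r ua qa za * cre k r um qm zm ∧
      Qcorr k r um qm zm ua qa za
        = R k r f g um ua.toFun + corrShift k r um qm zm ua qa za ∧
      |Q qS fS u.toFun - Q qS fS um.toFun - Qcorr k r um qm zm ua qa za|
        ≤ 1 / 2 * cre k r ua qa za * cre k r um qm zm := by
  obtain ⟨A, hA⟩ := hcoef.exists_isConstitutiveGap qm hm_fin
  obtain ⟨A', hA'⟩ := hcoef.exists_isConstitutiveGap qa ha_fin
  have herror := hcoef.norm_sq_energyMap_sub_le hT hu hm hA
  have hR := hcoef.Q_sub_Q_sub_R_eq_inner hT hu hm hA ha hA'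
  have hcorr := hcoef.Qcorr_eq_R_add_corrShift hm hA hA'
  rw [hcoef.cre_eq_norm hA, hcoef.cre_eq_norm hA']
  refine ⟨?_, hcorr, ?_⟩
  · rw [hR]
    exact (abs_real_inner_le_norm _ _).trans
      (mul_le_mul_of_nonneg_left (norm_le_of_norm_sq_le_inner herror) (norm_nonneg _))
  · rw [hcorr, ← sub_sub, hR, hcoef.corrShift_eq_inner hA hA', ← inner_sub_right, mul_comm (1 / 2),
      mul_assoc]
    exact (abs_real_inner_le_norm _ _).trans (mul_le_mul_of_nonneg_left
      (norm_sub_half_smul_le_of_norm_sq_le_inner herror) (norm_nonneg _))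

theorem mainTheorem2 {d : ℕ} (hd : 1 ≤ d)
    -- space domain and its boundary parts, time interval
    (Ω Γu Γq : Set (E d)) (hΩ_open : IsOpen Ω) (hΩ_bdd : Bornology.IsBounded Ω)
    (hΩ_lip : HasLipschitzBoundary Ω)
    (hΓu_meas : MeasurableSet Γu) (hΓq_meas : MeasurableSet Γq) (hΓu_ne : Γu.Nonempty)
    (hΓ_disj : Disjoint Γu Γq) (hΓu_sub : Γu ⊆ frontier Ω) (hΓq_sub : Γq ⊆ frontier Ω)
    (hΓ_cover : closure (Γu ∪ Γq) = frontier Ω)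
    (T : ℝ) (hT : 0 < T)
    -- parameter domain and coefficients
    {np : ℕ} (P : Set (Fin np → ℝ)) (c k r : (Fin np → ℝ) → E d → ℝ)
    (hcoef : ∀ p ∈ P, AdmissibleCoefficients Ω (c p) (k p) (r p))
    -- loads and extractors
    (f : L2Time T (L2 Ω)) (g : L2Time T (Lp ℝ 2 ((surfaceMeasure Ω).restrict Γq)))
    (qS : (Fin np → ℝ) → L2Time T (L2Vec Ω)) (fS : (Fin np → ℝ) → L2Time T (L2 Ω))
    -- exact solution
    (u : ∀ p, Evolution Ω Γu T (c p)) (hu : ∀ p ∈ P, IsWeakSolution (k p) (r p) f g (u p))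
    -- admissible primal triplet
    (um : ∀ p, Evolution Ω Γu T (c p)) (qm : (Fin np → ℝ) → L2Time T (L2Vec Ω))
    (zm : (Fin np → ℝ) → L2Time T (L2 Ω))
    (hm : ∀ p ∈ P, IsPrimalAdmissible f g (um p) (qm p) (zm p))
    (hm_fin : ∀ p ∈ P, HasFiniteCRE (r p) (um p) (zm p))
    -- admissible adjoint triplet
    (ua : ∀ p, Evolution Ω Γu T (c p)) (qa : (Fin np → ℝ) → L2Time T (L2Vec Ω))
    (za : (Fin np → ℝ) → L2Time T (L2 Ω))
    (ha : ∀ p ∈ P, IsAdjointAdmissible (qS p) (fS p) (ua p) (qa p) (za p))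
    (ha_fin : ∀ p ∈ P, HasFiniteCRE (r p) (ua p) (za p)) :
    ∀ p ∈ P,
      |Q (qS p) (fS p) (u p).toFun - Q (qS p) (fS p) (um p).toFun
          - R (k p) (r p) f g (um p) (ua p).toFun|
        ≤ cre (k p) (r p) (ua p) (qa p) (za p) * cre (k p) (r p) (um p) (qm p) (zm p) ∧
      Qcorr (k p) (r p) (um p) (qm p) (zm p) (ua p) (qa p) (za p)
        = R (k p) (r p) f g (um p) (ua p).toFun
          + corrShift (k p) (r p) (um p) (qm p) (zm p) (ua p) (qa p) (za p) ∧
      |Q (qS p) (fS p) (u p).toFun - Q (qS p) (fS p) (um p).toFun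
          - Qcorr (k p) (r p) (um p) (qm p) (zm p) (ua p) (qa p) (za p)|
        ≤ 1 / 2 * cre (k p) (r p) (ua p) (qa p) (za p)
            * cre (k p) (r p) (um p) (qm p) (zm p) := by
  intro p hp
  exact mainTheorem2_general hT (hcoef p hp) (hu p hp) (hm p hp) (hm_fin p hp) (ha p hp)
    (ha_fin p hp)
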